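/- Let $\mathbb H$ be the quaternions, let $\mathbb H^*=\mathbb H\setminus\{0\}$ act on $\mathbb H$ by ${}^{g}q=gqg^{-1}$, and let $O(q)$ be the orbit of $q$ (a point or a $2$-sphere; it is called nontrivial if it is not a point). A region is an open invariant set. For functions $F,G$ on an invariant set put $(F\diamond G)(x)=F({}^{G(x)}x)\,G(x)$ if $G(x)\ne0$ and $0$ if $G(x)=0$, and $(F\diamond_r G)(x)=F(x)\,G({}^{F(x)^{-1}}x)$ if $F(x)\neq 0$ and $0$ if $F(x)=0$. Let $T$ be the identity function, and let $(T-p)^{\langle-1\rangle_r}$ be the inverse of $T-p$ with respect to $\diamond_r$ on $\mathbb H\setminus O(p)$. A function $F:U\to\mathbb H$ on a region is skew regular if for every $q\in U$ there is $D:U\to\mathbb H$, continuous at all points of $O(q)$, with $F=F(q)+D\diamond(T-q)$ on $U$. A function $F$ is skew convex on an orbit $O$ if $F\diamond(a+b)=F\diamond a+F\diamond b$ on $O$ for all constants $a,b\in\mathbb H$; in that case, if $O=O(p)$ is nontrivial, its orbital derivative $F^o(p)$ is the common value of $(F(x)-F(y))(x-y)^{-1}$ over $x\ne y$ in $O$.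 For a nontrivial orbit $O=O(c)$ let $P_O(q)=q^2-2\operatorname{Re}(c)q+|c|^2$ and, for $R>0$, $U(O,R)=\{q\in\mathbb H: |P_O(q)|<R\}$. Let $\mathbb S=\{I\in\mathbb H: I^2=-1\}$, and identify $\mathbb R+\mathbb RI$ with $\mathbb C$ by $x+yI\mapsto x+yi$. Line integrals are defined by $\int_\gamma F(q)\,dq\,G(q)=\int_a^bF(\gamma(t))\gamma'(t)G(\gamma(t))\,dt$. **Proposition.** Let $F:U\to\mathbb H$ be skew regular on a region $U$, let $O$ be a nontrivial orbit and let $R>0$ be such that $\overline{U(O,R)}\subset U$. Let $I\in\mathbb S$, and let $\gamma$ be the positively oriented boundary of $U(O,R)\cap(\mathbb R+\mathbb RI)$, that is, any finite family of closed piecewise $C^1$ curves in $\mathbb R+\mathbb RI$ whose images together make up the boundary of this set relative to $\mathbb R+\mathbb RI$, and which has total winding number $1$ about every point of the set and $0$ about every point of $\mathbb R+\mathbb RI$ outside its closure. Such a $\gamma$ exists, and for each of them $$F(p)=\frac1{2\pi}\int_\gamma F(q)\,(-I\,dq)\,(T-p)^{\langle-1\rangle_r}(q)\qquad\text{for all }p\in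 U(O,R),$$ and, for all $p\in U(O,R)$ whose orbit is nontrivial (that is, $p\notin\mathbb R$), $F$ is skew convex on $O(p)$ and $$F^o(p)=\frac1{2\pi}\int_\gamma F(q)\,(-I\,dq)\,P_{O(p)}(q)^{-1}.$$ -/

import Mathlib

open scoped Quaternion

noncomputable section

namespace SkewAnalysis

/-! ## The conjugation action of the nonzero quaternions and the two skew products -/

/-- The action of a nonzero quaternion `g` on the quaternions: `q ↦ g q g⁻¹`. -/
def conj (g q : ℍ[ℝ]) : ℍ[ℝ] := g * q * g⁻¹

/-- The orbit of `q` under the conjugation action. -/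
def orbit (q : ℍ[ℝ]) : Set ℍ[ℝ] := {x | ∃ g : ℍ[ℝ], g ≠ 0 ∧ x = conj g q}

/-- A region: an open set which is invariant under the conjugation action. -/
def IsRegion (U : Set ℍ[ℝ]) : Prop :=
  IsOpen U ∧ ∀ g : ℍ[ℝ], g ≠ 0 → ∀ q ∈ U, conj g q ∈ U

open Classical in
/-- The (left) skew product `F ⋄ G`. Its restriction to an invariant set depends only on the
restrictions of `F` and `G` to that set. -/
def skewMul (F G : ℍ[ℝ] → ℍ[ℝ]) (x : ℍ[ℝ]) : ℍ[ℝ] :=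
  if G x = 0 then 0 else F (conj (G x) x) * G x

open Classical in
/-- The right skew product `F ⋄_r G`. -/
def rightSkewMul (F G : ℍ[ℝ] → ℍ[ℝ]) (x : ℍ[ℝ]) : ℍ[ℝ] :=
  if F x = 0 then 0 else F x * G (conj (F x)⁻¹ x)

/-- `F` is skew convex on the (invariant) set `X`: `F ⋄ (a + b) = F ⋄ a + F ⋄ b` on `X` for all
constants `a`, `b`. -/
def SkewConvexOn (X : Set ℍ[ℝ]) (F : ℍ[ℝ] → ℍ[ℝ]) : Prop :=
  ∀ a b : ℍ[ℝ], ∀ x ∈ X,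
    skewMul F (fun _ => a + b) x = skewMul F (fun _ => a) x + skewMul F (fun _ => b) x

/-- `G` is a two-sided inverse of `F` with respect to the right skew product, as functions on the
(invariant) set `X`. -/
def IsRightSkewInverseOn (X : Set ℍ[ℝ]) (F G : ℍ[ℝ] → ℍ[ℝ]) : Prop :=
  ∀ x ∈ X, rightSkewMul F G x = 1 ∧ rightSkewMul G F x = 1

/-- The inverse `F^{⟨-1⟩_r}` of `F` on `X` with respect to the right skew product. Only its values
on `X` are meaningful; there they are unique as soon as an inverse exists. -/
def rightSkewInverse (X : Set ℍ[ℝ]) (F : ℍ[ℝ] → ℍ[ℝ]) : ℍ[ℝ] → ℍ[ℝ] :=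
  Classical.epsilon (IsRightSkewInverseOn X F)

/-- The function `(T - p)^{⟨-1⟩_r}`, on the complement of the orbit of `p`. -/
def cauchyKernel (p : ℍ[ℝ]) : ℍ[ℝ] → ℍ[ℝ] :=
  rightSkewInverse (orbit p)ᶜ (fun q => q - p)

/-! ## Skew regular functions and the orbital derivative -/

/-- `F` is (left) skew differentiable at `q ∈ U`: `F = F(q) + D ⋄ (T - q)` on `U` for some `D`
which is continuous at all points of the orbit of `q`. -/
def SkewDifferentiableAt (U : Set ℍ[ℝ]) (F : ℍ[ℝ] → ℍ[ℝ]) (q : ℍ[ℝ]) : Prop :=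
  ∃ D : ℍ[ℝ] → ℍ[ℝ], (∀ p ∈ orbit q, ContinuousAt D p) ∧
    ∀ x ∈ U, F x = F q + skewMul D (fun t => t - q) x

/-- `F` is (left) skew regular on the region `U`. -/
def SkewRegularOn (U : Set ℍ[ℝ]) (F : ℍ[ℝ] → ℍ[ℝ]) : Prop :=
  ∀ q ∈ U, SkewDifferentiableAt U F q

/-- `F` is skew convex on the orbit of `p`, and its orbital derivative there is `c`: the common
value of the quotients `(F x - F y) (x - y)⁻¹` on a nontrivial orbit, and `0` on a trivial one. -/
def HasOrbitalDeriv (F : ℍ[ℝ] → ℍ[ℝ]) (c p : ℍ[ℝ]) : Prop :=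
  SkewConvexOn (orbit p) F ∧
    ((orbit p).Nontrivial → ∀ x ∈ orbit p, ∀ y ∈ orbit p, x ≠ y →
      (F x - F y) * (x - y)⁻¹ = c) ∧
    (¬ (orbit p).Nontrivial → c = 0)

/-! ## The polynomial of an orbit -/

open Classical in
/-- The value at `q` of the polynomial `P_O(T)` attached to the orbit `O` of `c`. -/
def orbitPoly (c q : ℍ[ℝ]) : ℍ[ℝ] :=
  if (orbit c).Nontrivial then q ^ 2 - ((2 * c.re : ℝ) : ℍ[ℝ]) * q + ((‖c‖ ^ 2 : ℝ) : ℍ[ℝ])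
  else q - c

/-- The set `U(O, R)`, where `O` is the orbit of `c`. -/
def orbitNhd (c : ℍ[ℝ]) (R : ℝ) : Set ℍ[ℝ] := {q | ‖orbitPoly c q‖ < R}

/-! ## Slices, boundary cycles and line integrals -/

/-- The identification `x + y i ↦ x + y I` of the complex plane with `ℝ + ℝ I`. -/
def sliceEmb (I : ℍ[ℝ]) (z : ℂ) : ℍ[ℝ] := (z.re : ℍ[ℝ]) + (z.im : ℍ[ℝ]) * I

/-- A closed piecewise continuously differentiable curve `[a, b] → ℂ`. It is continuously
differentiable on each closed subinterval whose interior avoids a finite set of break points. -/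
structure Loop where
  a : ℝ
  b : ℝ
  lt : a < b
  toFun : ℝ → ℂ
  cont : ContinuousOn toFun (Set.Icc a b)
  piecewise : ∃ s : Finset ℝ, ∀ c d : ℝ, a ≤ c → c < d → d ≤ b →
    (∀ t ∈ s, t ∉ Set.Ioo c d) → ContDiffOn ℝ 1 toFun (Set.Icc c d)
  closed : toFun a = toFun b

/-- The winding number of a loop about a point off the loop. -/
def Loop.index (γ : Loop) (w : ℂ) : ℂ :=
  (2 * Real.pi * Complex.I)⁻¹ * ∫ t in γ.a..γ.b, deriv γ.toFun t / (γ.toFun t - w)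

/-- The finite family of loops `γ` is the (positively oriented) boundary of the open set
`D ⊆ ℂ`: it traces out the topological boundary of `D`, it winds once around each point of `D`
and it does not wind around points outside the closure of `D`. -/
def IsOrientedBoundary {n : ℕ} (γ : Fin n → Loop) (D : Set ℂ) : Prop :=
  (⋃ j, (γ j).toFun '' Set.Icc (γ j).a (γ j).b) = frontier D ∧
    (∀ w ∈ D, ∑ j, (γ j).index w = 1) ∧
    (∀ w ∉ closure D, ∑ j, (γ j).index w = 0)

/-- The line integral `∫ F(q) dq G(q)` along a curve `σ : [a, b] → ℍ`. -/
def lineIntegral (a b : ℝ) (σ : ℝ → ℍ[ℝ]) (F G : ℍ[ℝ] → ℍ[ℝ]) : ℍ[ℝ] :=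
  ∫ t in a..b, F (σ t) * deriv σ t * G (σ t)

/-- The integral `∫_γ F(q) (-I dq) G(q)` over a family `γ` of loops in the plane `ℝ + ℝ I`. -/
def cycleIntegral (I : ℍ[ℝ]) {n : ℕ} (γ : Fin n → Loop) (F G : ℍ[ℝ] → ℍ[ℝ]) : ℍ[ℝ] :=
  ∑ j, lineIntegral (γ j).a (γ j).b (fun t => sliceEmb I ((γ j).toFun t))
    (fun q => F q * (-I)) G

end SkewAnalysis

end

open SkewAnalysis

noncomputable section

namespace SkewAnalysis

open Set Filter Topology MeasureTheory Metric

/-! ## Integrals along loops -/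

/-! On the slice `ℝ + ℝ I` the points `w`, `z` commute, so skew differentiability reads `F(w) = F(z)
+ D(w)(w - z)`, and `F` is holomorphic for right multiplication by the slice. On an orbit, `(x - y)
x (x - y)⁻¹ = ȳ` gives `F(x) - F(y) = C (x - y)` with one constant `C`. This is skew convexity, with
`C` the orbital derivative (`exists_orbital_const`, `skewConvexOn_of_affine`).

The kernel is `P(q)⁻¹ (q - p̄)`, with `P` the real quadratic polynomial vanishing at `p`
(`cauchyKernel_eq`). If `z` is a point of the slice in `O(p)`, then `P = (w - z)(w - z̄)` there. For
nonreal `p`, partial fractions and Cauchy's formula at `z` and `z̄` evaluate `∫ F P⁻¹` as `2π C` and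
`∫ F w P⁻¹` as `2π (F(z) + C z̄)` (`sliceIntegral_quad`). The kernel integral is therefore `2π (F(z)
+ C (z̄ - p̄)) = 2π (F(z) + C (p - z)) = 2π F(p)`. For real `p` the kernel is `(w - p)⁻¹`.

The slice of `U(O,R)` is `|φ| < R` with `φ(w) = (w - a)² + β`. Cauchy's theorem for a cycle known
only by its winding numbers uses this form: a holomorphic function is `E₀(φ) + (w - a) E₁(φ)`, and
Taylor polynomials of `E₀`, `E₁` approximate it uniformly by entire functions
(`Loop.integral_eq_zero_of_lemniscate`). A boundary cycle comes from lifting the circle `|φ| = R`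
through the square root (`exists_isOrientedBoundary`). -/

theorem intervalIntegrable_deriv_of_piecewise {f : ℝ → ℂ} (s : Finset ℝ) :
    ∀ {a b : ℝ}, a ≤ b →
      (∀ c d : ℝ, a ≤ c → c < d → d ≤ b → (∀ t ∈ s, t ∉ Ioo c d) → ContDiffOn ℝ 1 f (Icc c d)) →
      IntervalIntegrable (deriv f) volume a b := by
  induction s using Finset.induction with
  | empty =>
    intro a b hab h
    rcases hab.eq_or_lt with rfl | hab
    · exact IntervalIntegrable.refl
    have hc := h a b le_rfl hab le_rfl (by simp)
    have hd := hc.continuousOn_derivWithin (uniqueDiffOn_Icc hab) le_rfl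
    rw [← uIcc_of_le hab.le] at hd
    -- At the endpoints the two-sided derivative may differ from the one-sided one, so the
    -- comparison is made on the open interval only.
    refine hd.intervalIntegrable.congr_uIoo fun t ht => ?_
    rw [uIoo_of_le hab.le] at ht
    rw [uIcc_of_le hab.le]
    exact derivWithin_of_mem_nhds (Icc_mem_nhds ht.1 ht.2)
  | insert m s _ ih =>
    intro a b hab h
    by_cases hm : m ∈ Ioo a b
    · refine (ih hm.1.le fun c d hac hcd hdm hs => ?_).trans
        (ih hm.2.le fun c d hac hcd hdm hs => ?_)
      · refine h c d hac hcd (hdm.trans hm.2.le) fun t ht => ?_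
        rcases Finset.mem_insert.1 ht with rfl | ht
        · exact fun hx => absurd hx.2 hdm.not_gt
        · exact hs t ht
      · refine h c d (hm.1.le.trans hac) hcd hdm fun t ht => ?_
        rcases Finset.mem_insert.1 ht with rfl | ht
        · exact fun hx => absurd hx.1 hac.not_gt
        · exact hs t ht
    · refine ih hab fun c d hac hcd hdb hs => h c d hac hcd hdb fun t ht => ?_
      rcases Finset.mem_insert.1 ht with rfl | ht
      · exact fun hx => hm ⟨hac.trans_lt hx.1, hx.2.trans_le hdb⟩
      · exact hs t ht

/-- The image of a loop. -/
def Loop.image (γ : Loop) : Set ℂ := γ.toFun '' Icc γ.a γ.b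

theorem Loop.intervalIntegrable_deriv (γ : Loop) :
    IntervalIntegrable (deriv γ.toFun) volume γ.a γ.b := by
  obtain ⟨s, hs⟩ := γ.piecewise
  exact intervalIntegrable_deriv_of_piecewise s γ.lt.le hs

theorem Loop.intervalIntegrable_mul_deriv (γ : Loop) {h : ℂ → ℂ} (hh : ContinuousOn h γ.image) :
    IntervalIntegrable (fun t => h (γ.toFun t) * deriv γ.toFun t) volume γ.a γ.b := by
  refine γ.intervalIntegrable_deriv.continuousOn_mul ?_
  rw [uIcc_of_le γ.lt.le]
  exact hh.comp γ.cont (mapsTo_image _ _)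

theorem Loop.exists_finset_differentiableAt (γ : Loop) :
    ∃ s : Finset ℝ, ∀ t ∈ Ioo γ.a γ.b \ s, DifferentiableAt ℝ γ.toFun t := by
  obtain ⟨s, hs⟩ := γ.piecewise
  refine ⟨s, fun t ht => ?_⟩
  have hn : Ioo γ.a γ.b \ (s : Set ℝ) ∈ 𝓝 t :=
    (isOpen_Ioo.sdiff s.finite_toSet.isClosed).mem_nhds ht
  obtain ⟨ε, hε, hsub⟩ := nhds_basis_closedBall.mem_iff.1 hn
  rw [Real.closedBall_eq_Icc] at hsub
  have h1 := hsub (left_mem_Icc.2 (by linarith))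
  have h2 := hsub (right_mem_Icc.2 (by linarith))
  have := hs (t - ε) (t + ε) h1.1.1.le (by linarith) h2.1.2.le
    fun u hu hmem => (hsub (Ioo_subset_Icc_self hmem)).2 hu
  exact (this.differentiableOn one_ne_zero).differentiableAt (Icc_mem_nhds (by linarith) (by linarith))

theorem Loop.integral_eq_zero_of_differentiable (γ : Loop) {p : ℂ → ℂ} (hp : Differentiable ℂ p) :
    ∫ t in γ.a..γ.b, p (γ.toFun t) * deriv γ.toFun t = 0 := by
  obtain ⟨P, hP⟩ := hp.isExactOn_univ
  have hP : ∀ z, HasDerivAt P (p z) z := fun z => hP z (mem_univ z)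
  obtain ⟨s, hs⟩ := γ.exists_finset_differentiableAt
  have hPc : Continuous P := continuous_iff_continuousAt.2 fun z => (hP z).continuousAt
  have := integral_eq_of_hasDerivAt_off_countable (fun t => P (γ.toFun t))
    (fun t => p (γ.toFun t) * deriv γ.toFun t) (a := γ.a) (b := γ.b) s.countable_toSet
    (by rw [uIcc_of_le γ.lt.le]; exact hPc.comp_continuousOn γ.cont)
    (by
      rw [min_eq_left γ.lt.le, max_eq_right γ.lt.le]
      exact fun t ht => (hP _).comp t (hs t ht).hasDerivAt)
    (γ.intervalIntegrable_mul_deriv hp.continuous.continuousOn)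
  rw [this, γ.closed, sub_self]

/-- If `h` is a uniform limit of functions with vanishing integral, its integral vanishes. -/
theorem Loop.integral_eq_zero_of_tendstoUniformlyOn (γ : Loop) {h : ℂ → ℂ} {p : ℕ → ℂ → ℂ}
    (hh : ContinuousOn h γ.image) (hp : ∀ n, Differentiable ℂ (p n))
    (hlim : TendstoUniformlyOn p h atTop γ.image) :
    ∫ t in γ.a..γ.b, h (γ.toFun t) * deriv γ.toFun t = 0 := by
  have hle := γ.lt.le
  set M := ∫ t in γ.a..γ.b, ‖deriv γ.toFun t‖ with hM
  have hM0 : 0 ≤ M := intervalIntegral.integral_nonneg hle fun _ _ => norm_nonneg _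
  rw [← norm_le_zero_iff]
  refine le_of_forall_pos_le_add fun ε hε => ?_
  rw [zero_add]
  -- `M + 1` replaces `M` because `M` vanishes for a constant loop.
  obtain ⟨n, hn⟩ := (Metric.tendstoUniformlyOn_iff.1 hlim (ε / (M + 1)) (by positivity)).exists
  have hsub : ∫ t in γ.a..γ.b, h (γ.toFun t) * deriv γ.toFun t =
      ∫ t in γ.a..γ.b, (h (γ.toFun t) - p n (γ.toFun t)) * deriv γ.toFun t := by
    simp_rw [sub_mul]
    rw [intervalIntegral.integral_sub (γ.intervalIntegrable_mul_deriv hh)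
      (γ.intervalIntegrable_mul_deriv (hp n).continuous.continuousOn),
      γ.integral_eq_zero_of_differentiable (hp n), sub_zero]
  rw [hsub]
  calc _ ≤ ∫ t in γ.a..γ.b, ε / (M + 1) * ‖deriv γ.toFun t‖ := by
        refine intervalIntegral.norm_integral_le_of_norm_le hle
          (Eventually.of_forall fun t ht => ?_) (γ.intervalIntegrable_deriv.norm.const_mul _)
        rw [norm_mul]
        gcongr
        rw [← dist_eq_norm]
        exact (hn _ (mem_image_of_mem _ (Ioc_subset_Icc_self ht))).le
    _ = ε / (M + 1) * M := by rw [intervalIntegral.integral_const_mul]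
    _ ≤ ε := by
        rw [div_mul_eq_mul_div, div_le_iff₀ (by positivity)]
        nlinarith

/-! ## Cauchy's theorem on the domain `‖(w - a) ^ 2 + β‖ < r` -/

theorem sqrt_pow_two (z : ℂ) : Complex.sqrt z ^ 2 = z := by
  simp [Complex.sqrt]

/-- This makes the choice of the branch of the square root immaterial. -/
theorem apply_add_eq_of_even {e : ℂ → ℂ} {a : ℂ} (heven : ∀ w, e (2 * a - w) = e w) {u v : ℂ}
    (h : u ^ 2 = v ^ 2) : e (a + u) = e (a + v) := by
  rcases sq_eq_sq_iff_eq_or_eq_neg.1 h with rfl | rfl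
  · rfl
  · rw [← heven]; congr 1; ring

theorem isOpen_lemniscate (a β : ℂ) (r : ℝ) : IsOpen {w : ℂ | ‖(w - a) ^ 2 + β‖ < r} :=
  isOpen_lt (by fun_prop) continuous_const

/-- A function which is even about `a` is holomorphic as a function of `(w - a) ^ 2 + β`. -/
theorem exists_comp_of_even {e : ℂ → ℂ} {a β : ℂ} {r : ℝ}
    (he : DifferentiableOn ℂ e {w | ‖(w - a) ^ 2 + β‖ < r}) (heven : ∀ w, e (2 * a - w) = e w) :
    ∃ E : ℂ → ℂ, DifferentiableOn ℂ E (ball 0 r) ∧ ∀ w, e w = E ((w - a) ^ 2 + β) := by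
  set E : ℂ → ℂ := fun x => e (a + Complex.sqrt (x - β)) with hE
  have hmem : ∀ {x u : ℂ}, x ∈ ball (0 : ℂ) r → u ^ 2 = x - β →
      a + u ∈ {w : ℂ | ‖(w - a) ^ 2 + β‖ < r} := by
    intro x u hx hu
    simpa [hu] using hx
  have hd : ∀ x ∈ ball (0 : ℂ) r, x ≠ β → DifferentiableAt ℂ E x := by
    intro x hx hxβ
    obtain ⟨u, hu2⟩ : ∃ u : ℂ, u ^ 2 = x - β := ⟨_, sqrt_pow_two _⟩
    have hu0 : u ^ 2 ≠ 0 := by rw [hu2]; exact sub_ne_zero.2 hxβ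
    -- The principal branch may jump at `x - β`. The root used instead is `u` times the principal
    -- root of a quantity equal to `1` at `y = x`, hence holomorphic near `x`.
    have hEq : E = fun y => e (a + u * Complex.sqrt ((y - β) / u ^ 2)) := by
      funext y
      refine apply_add_eq_of_even heven ?_
      rw [mul_pow, sqrt_pow_two, sqrt_pow_two, mul_div_cancel₀ _ hu0]
    have h1 : (x - β) / u ^ 2 = 1 := by rw [hu2, div_self (sub_ne_zero.2 hxβ)]
    have hin : DifferentiableAt ℂ (fun y => a + u * Complex.sqrt ((y - β) / u ^ 2)) x := by
      refine (DifferentiableAt.const_mul ?_ u).const_add a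
      refine DifferentiableAt.comp x (g := Complex.sqrt) (Complex.differentiableAt_sqrt ?_)
        (by fun_prop)
      rw [h1]; exact Complex.one_mem_slitPlane
    rw [hEq]
    refine DifferentiableAt.comp x (g := e) (he.differentiableAt ?_) hin
    refine (isOpen_lemniscate a β r).mem_nhds (hmem hx ?_)
    rw [mul_pow, sqrt_pow_two, mul_div_cancel₀ _ hu0]
  refine ⟨E, fun x hx => ?_, fun w => ?_⟩
  · by_cases hxβ : x = β
    · subst hxβ
      -- The branch point is a removable singularity, since the square root is still continuous
      -- there.
      refine (Complex.analyticAt_of_differentiable_on_punctured_nhds_of_continuousAt ?_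
        ?_).differentiableAt.differentiableWithinAt
      · filter_upwards [self_mem_nhdsWithin, mem_nhdsWithin_of_mem_nhds (isOpen_ball.mem_nhds hx)]
          with y hy hyr using hd y hyr hy
      · have hs : ContinuousAt (fun y => a + Complex.sqrt (y - x)) x := by
          refine continuousAt_const.add (ContinuousAt.comp (g := Complex.sqrt) ?_ (by fun_prop))
          exact Complex.continuousAt_sqrt (by simp)
        refine ContinuousAt.comp (g := e) (he.differentiableAt ?_).continuousAt hs
        exact (isOpen_lemniscate a x r).mem_nhds (hmem hx (sqrt_pow_two _))
    · exact (hd x hx hxβ).differentiableWithinAt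
  · have := apply_add_eq_of_even heven (u := w - a)
      (v := Complex.sqrt ((w - a) ^ 2 + β - β)) (by rw [sqrt_pow_two]; ring)
    simp only [hE]
    rw [← this, add_sub_cancel]

theorem exists_tendstoUniformlyOn_of_ball {E : ℂ → ℂ} {R r : ℝ} (hR : 0 < R) (hRr : R < r)
    (hE : DifferentiableOn ℂ E (ball 0 r)) :
    ∃ p : ℕ → ℂ → ℂ, (∀ n, Differentiable ℂ (p n)) ∧
      TendstoUniformlyOn p E atTop (closedBall 0 R) := by
  -- `r₂` leaves room for the Cauchy power series inside the domain; `r₁` is a smaller radius on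
  -- which its partial sums converge uniformly.
  obtain ⟨r₂, h2, h2r⟩ := exists_between hRr
  obtain ⟨r₁, h1, h12⟩ := exists_between h2
  lift r₂ to NNReal using by linarith
  lift r₁ to NNReal using by linarith
  have hps := (hE.mono (closedBall_subset_ball h2r)).hasFPowerSeriesOnBall
    (show 0 < r₂ by exact_mod_cast hR.trans h2)
  refine ⟨fun n y => (cauchyPowerSeries E 0 r₂).partialSum n (y - 0), fun n => ?_,
    (hps.tendstoUniformlyOn' (ENNReal.coe_lt_coe.2 (by exact_mod_cast h12))).mono
      (closedBall_subset_ball h1)⟩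
  simp only [FormalMultilinearSeries.partialSum, FormalMultilinearSeries.apply_eq_pow_smul_coeff]
  fun_prop

/-- Cauchy's theorem for a loop in a closed lemniscate domain, for functions of the form
`(w - a) ^ k * E ((w - a) ^ 2 + β)`. -/
theorem Loop.integral_pow_mul_comp_eq_zero (γ : Loop) {E : ℂ → ℂ} {a β : ℂ} {R r : ℝ} (hR : 0 < R)
    (hRr : R < r) (hE : DifferentiableOn ℂ E (ball 0 r))
    (hγ : ∀ w ∈ γ.image, ‖(w - a) ^ 2 + β‖ ≤ R) (k : ℕ) :
    ∫ t in γ.a..γ.b, ((γ.toFun t - a) ^ k * E ((γ.toFun t - a) ^ 2 + β)) * deriv γ.toFun t = 0 := by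
  obtain ⟨p, hp, hlim⟩ := exists_tendstoUniformlyOn_of_ball hR hRr hE
  have hmaps : MapsTo (fun w : ℂ => (w - a) ^ 2 + β) γ.image (closedBall 0 R) :=
    fun w hw => by simpa using hγ w hw
  have hcont : ContinuousOn (fun w => (w - a) ^ k * E ((w - a) ^ 2 + β)) γ.image := by
    refine ContinuousOn.mul (by fun_prop) ?_
    exact ((hE.continuousOn.mono (closedBall_subset_ball hRr)).comp (by fun_prop) hmaps)
  refine γ.integral_eq_zero_of_tendstoUniformlyOn (h := fun w => (w - a) ^ k * E ((w - a) ^ 2 + β))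
    (p := fun n w => (w - a) ^ k * p n ((w - a) ^ 2 + β)) hcont (fun n => ?_) ?_
  · refine Differentiable.mul (by fun_prop) ((hp n).comp (by fun_prop))
  · have hK : IsCompact γ.image := isCompact_Icc.image_of_continuousOn γ.cont
    obtain ⟨C, hC⟩ := hK.exists_bound_of_continuousOn (f := fun w : ℂ => (w - a) ^ k)
      (by fun_prop)
    have hC' : 0 < |C| + 1 := by positivity
    rw [Metric.tendstoUniformlyOn_iff] at hlim ⊢
    intro ε hε
    filter_upwards [hlim (ε / (|C| + 1)) (by positivity)] with n hn w hw
    rw [dist_eq_norm, ← mul_sub, norm_mul, ← dist_eq_norm]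
    calc _ ≤ (|C| + 1) * dist (E ((w - a) ^ 2 + β)) (p n ((w - a) ^ 2 + β)) := by
          gcongr; linarith [hC w hw, le_abs_self C]
      _ < (|C| + 1) * (ε / (|C| + 1)) := by gcongr; exact hn _ (hmaps hw)
      _ = ε := by field_simp

/-- The part of `h` even about `a` is a function of `(w - a) ^ 2 + β`, and the odd part is `w - a`
times such a function. The domain may be disconnected, but this splitting does not see it. -/
theorem Loop.integral_eq_zero_of_lemniscate (γ : Loop) {h : ℂ → ℂ} {a β : ℂ} {R r : ℝ} (hR : 0 < R)
    (hRr : R < r) (hh : DifferentiableOn ℂ h {w | ‖(w - a) ^ 2 + β‖ < r})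
    (hγ : ∀ w ∈ γ.image, ‖(w - a) ^ 2 + β‖ ≤ R) :
    ∫ t in γ.a..γ.b, h (γ.toFun t) * deriv γ.toFun t = 0 := by
  set S : Set ℂ := {w | ‖(w - a) ^ 2 + β‖ < r} with hS
  have hSo : IsOpen S := isOpen_lemniscate a β r
  have hrefl : DifferentiableOn ℂ (fun w => h (2 * a - w)) S := by
    refine hh.comp (by fun_prop) fun w hw => ?_
    have : (2 * a - w - a) ^ 2 = (w - a) ^ 2 := by ring
    simpa [hS, this] using hw
  set o : ℂ → ℂ := fun w => (h w - h (2 * a - w)) / 2 with ho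
  have hoa : o a = 0 := by simp [ho, two_mul]
  have hod : DifferentiableOn ℂ o S := (hh.sub hrefl).div_const 2
  -- The odd part vanishes at `a`, so dividing it by `w - a` creates no singularity.
  have hslope : DifferentiableOn ℂ (dslope o a) S := by
    by_cases ha : a ∈ S
    · exact (Complex.differentiableOn_dslope (hSo.mem_nhds ha)).2 hod
    · exact (differentiableOn_dslope_of_notMem ha).2 hod
  obtain ⟨E₀, hE₀, he₀⟩ := exists_comp_of_even (e := fun w => (h w + h (2 * a - w)) / 2)
    ((hh.add hrefl).div_const 2) (fun w => by rw [sub_sub_cancel, add_comm])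
  obtain ⟨E₁, hE₁, he₁⟩ := exists_comp_of_even (e := dslope o a) hslope (fun w => by
    by_cases hw : w = a
    · subst hw; congr 1; ring
    · have hw' : 2 * a - w ≠ a := fun h' => hw (by linear_combination -h')
      rw [dslope_of_ne _ hw, dslope_of_ne _ hw', slope_def_field, slope_def_field, hoa]
      have h1 : w - a ≠ 0 := sub_ne_zero.2 hw
      have h2 : o (2 * a - w) = -o w := by simp only [ho, sub_sub_cancel]; ring
      rw [h2, show 2 * a - w - a = -(w - a) by ring]
      field_simp
      ring)
  have hsum : ∀ w, h w = (w - a) ^ 0 * E₀ ((w - a) ^ 2 + β) +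
      (w - a) ^ 1 * E₁ ((w - a) ^ 2 + β) := by
    intro w
    rw [← he₀, ← he₁, pow_zero, pow_one, one_mul]
    have : (w - a) * dslope o a w = o w := by
      have := sub_smul_dslope o a w
      rwa [hoa, sub_zero, smul_eq_mul] at this
    rw [this]; simp only [ho]; ring
  have hmaps : MapsTo (fun w : ℂ => (w - a) ^ 2 + β) γ.image (ball 0 r) :=
    fun w hw => by simpa using (hγ w hw).trans_lt hRr
  have hint : ∀ (E : ℂ → ℂ) (k : ℕ), DifferentiableOn ℂ E (ball 0 r) →
      IntervalIntegrable (fun t => ((γ.toFun t - a) ^ k * E ((γ.toFun t - a) ^ 2 + β)) *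
        deriv γ.toFun t) volume γ.a γ.b := fun E k hE =>
    γ.intervalIntegrable_mul_deriv (h := fun w => (w - a) ^ k * E ((w - a) ^ 2 + β))
      (ContinuousOn.mul (by fun_prop) (hE.continuousOn.comp (by fun_prop) hmaps))
  simp_rw [hsum, add_mul]
  rw [intervalIntegral.integral_add (hint E₀ 0 hE₀) (hint E₁ 1 hE₁),
    γ.integral_pow_mul_comp_eq_zero hR hRr hE₀ hγ, γ.integral_pow_mul_comp_eq_zero hR hRr hE₁ hγ,
    add_zero]

/-! ### Closure, frontier and neighbourhoods of lemniscate domains -/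

theorem isOpenMap_lemniscate (a β : ℂ) : IsOpenMap fun w : ℂ => (w - a) ^ 2 + β := by
  have han : AnalyticOnNhd ℂ (fun w : ℂ => (w - a) ^ 2 + β) univ := fun z _ => by fun_prop
  rcases han.is_constant_or_isOpen isPreconnected_univ with ⟨c, hc⟩ | h
  · have h0 := hc a (mem_univ _)
    have h1 := hc (a + 1) (mem_univ _)
    simp only [sub_self, add_sub_cancel_left] at h0 h1
    have : (1 : ℂ) = 0 := by linear_combination h1 - h0
    exact absurd this one_ne_zero
  · exact fun s hs => h s (subset_univ _) hs

/-- Preimages under a continuous open map commute with closure and frontier. This also covers the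
singular curve, where `a` itself lies on the boundary. -/
theorem closure_lemniscate (a β : ℂ) {R : ℝ} (hR : 0 < R) :
    closure {w : ℂ | ‖(w - a) ^ 2 + β‖ < R} = {w | ‖(w - a) ^ 2 + β‖ ≤ R} := by
  have := (isOpenMap_lemniscate a β).preimage_closure_eq_closure_preimage (by fun_prop) (ball 0 R)
  rw [closure_ball _ hR.ne'] at this
  simpa [preimage, Set.ext_iff] using this.symm

theorem frontier_lemniscate (a β : ℂ) {R : ℝ} (hR : 0 < R) :
    frontier {w : ℂ | ‖(w - a) ^ 2 + β‖ < R} = {w | ‖(w - a) ^ 2 + β‖ = R} := by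
  have := (isOpenMap_lemniscate a β).preimage_frontier_eq_frontier_preimage (by fun_prop) (ball 0 R)
  rw [frontier_ball _ hR.ne'] at this
  simpa [preimage, Set.ext_iff] using this.symm

/-- The part of a slightly larger closed lemniscate outside `V` is compact, so the defining modulus
attains a minimum there, which exceeds `R`. -/
theorem exists_lemniscate_subset {a β : ℂ} {R : ℝ} {V : Set ℂ} (hV : IsOpen V)
    (h : {w | ‖(w - a) ^ 2 + β‖ ≤ R} ⊆ V) :
    ∃ r > R, {w | ‖(w - a) ^ 2 + β‖ < r} ⊆ V := by
  have hcpt : IsCompact ({w : ℂ | ‖(w - a) ^ 2 + β‖ ≤ R + 1} ∩ Vᶜ) := by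
    refine IsCompact.inter_right ?_ hV.isClosed_compl
    refine Metric.isCompact_of_isClosed_isBounded (isClosed_le (by fun_prop) continuous_const) ?_
    refine (isBounded_closedBall (x := a) (r := R + 1 + ‖β‖ + 1)).subset fun w hw => ?_
    have hw : ‖(w - a) ^ 2 + β‖ ≤ R + 1 := hw
    have h1 : ‖(w - a) ^ 2‖ ≤ R + 1 + ‖β‖ := by
      calc ‖(w - a) ^ 2‖ = ‖((w - a) ^ 2 + β) - β‖ := by rw [add_sub_cancel_right]
        _ ≤ _ := (norm_sub_le _ _).trans (by linarith)
    rw [norm_pow] at h1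
    rw [mem_closedBall, dist_eq_norm]
    nlinarith [sq_nonneg (‖w - a‖ - 1), norm_nonneg (w - a)]
  rcases ({w : ℂ | ‖(w - a) ^ 2 + β‖ ≤ R + 1} ∩ Vᶜ).eq_empty_or_nonempty with he | hne
  · refine ⟨R + 1, by linarith, fun w hw => ?_⟩
    by_contra hwV
    exact he.subset ⟨show _ ≤ R + 1 from le_of_lt hw, hwV⟩
  · obtain ⟨m, hm, hmin⟩ := hcpt.exists_isMinOn hne
      (f := fun w => ‖(w - a) ^ 2 + β‖) (by fun_prop)
    refine ⟨min (R + 1) ‖(m - a) ^ 2 + β‖, lt_min (by linarith) ?_, fun w hw => ?_⟩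
    · by_contra hle
      exact hm.2 (h (not_lt.1 hle))
    · by_contra hwV
      have hw' := lt_min_iff.1 (Set.mem_ofPred_eq ▸ hw : ‖(w - a) ^ 2 + β‖ < _)
      exact absurd (hmin ⟨hw'.1.le, hwV⟩) (not_le.2 hw'.2)

theorem IsOrientedBoundary.sub_ne_zero_of_mem {n : ℕ} {γ : Fin n → Loop} {a β z : ℂ} {R : ℝ} (hR : 0 < R)
    (hγ : IsOrientedBoundary γ {w | ‖(w - a) ^ 2 + β‖ < R}) (hz : ‖(z - a) ^ 2 + β‖ < R)
    (j : Fin n) {w : ℂ} (hw : w ∈ (γ j).image) : w - z ≠ 0 := fun h0 => by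
  have : w ∈ frontier {w | ‖(w - a) ^ 2 + β‖ < R} := hγ.1.subset (mem_iUnion.2 ⟨j, hw⟩)
  rw [sub_eq_zero.1 h0, frontier_lemniscate a β hR] at this
  exact hz.ne this

/-- Cauchy's integral formula for an oriented boundary of a lemniscate domain. -/
theorem IsOrientedBoundary.cauchy_formula {n : ℕ} {γ : Fin n → Loop} {a β : ℂ} {R : ℝ} (hR : 0 < R)
    (hγ : IsOrientedBoundary γ {w | ‖(w - a) ^ 2 + β‖ < R}) {V : Set ℂ} (hV : IsOpen V)
    (hDV : closure {w | ‖(w - a) ^ 2 + β‖ < R} ⊆ V) {f : ℂ → ℂ} (hf : DifferentiableOn ℂ f V)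
    {z : ℂ} (hz : ‖(z - a) ^ 2 + β‖ < R) :
    ∑ j, ∫ t in (γ j).a..(γ j).b, f ((γ j).toFun t) * ((γ j).toFun t - z)⁻¹ *
      deriv (γ j).toFun t = 2 * Real.pi * Complex.I * f z := by
  obtain ⟨hfr, hin, -⟩ := id hγ
  rw [frontier_lemniscate a β hR] at hfr
  rw [closure_lemniscate a β hR] at hDV
  obtain ⟨r, hRr, hrV⟩ := exists_lemniscate_subset hV hDV
  have himg : ∀ j, ∀ w ∈ (γ j).image, ‖(w - a) ^ 2 + β‖ = R := fun j w hw =>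
    hfr.subset (mem_iUnion.2 ⟨j, hw⟩)
  have hne := fun j w hw => hγ.sub_ne_zero_of_mem hR hz j (w := w) hw
  have hfS : DifferentiableOn ℂ f {w | ‖(w - a) ^ 2 + β‖ < r} := hf.mono hrV
  -- The quotient `(f w - f z) / (w - z)` extends holomorphically over `z` and integrates to zero,
  -- leaving `f z` times the winding number.
  have hd : DifferentiableOn ℂ (dslope f z) {w | ‖(w - a) ^ 2 + β‖ < r} :=
    (Complex.differentiableOn_dslope
      ((isOpen_lemniscate a β r).mem_nhds (hz.trans hRr))).2 hfS
  have hinv : ∀ j, ContinuousOn (fun w => (w - z)⁻¹) (γ j).image := fun j =>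
    ContinuousOn.inv₀ (by fun_prop) (hne j)
  have hfc : ∀ j, ContinuousOn f (γ j).image := fun j =>
    hfS.continuousOn.mono fun w hw => (himg j w hw).trans_lt hRr
  have key : ∀ j, ∫ t in (γ j).a..(γ j).b, f ((γ j).toFun t) * ((γ j).toFun t - z)⁻¹ *
      deriv (γ j).toFun t = f z * (2 * Real.pi * Complex.I * (γ j).index z) := by
    intro j
    have h0 := (γ j).integral_eq_zero_of_lemniscate hR hRr hd fun w hw => (himg j w hw).le
    have heq : ∫ t in (γ j).a..(γ j).b, dslope f z ((γ j).toFun t) * deriv (γ j).toFun t =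
        ∫ t in (γ j).a..(γ j).b, (f ((γ j).toFun t) * ((γ j).toFun t - z)⁻¹ *
          deriv (γ j).toFun t - f z * (((γ j).toFun t - z)⁻¹ * deriv (γ j).toFun t)) := by
      refine intervalIntegral.integral_congr fun t ht => ?_
      rw [uIcc_of_le (γ j).lt.le] at ht
      have := hne j _ (mem_image_of_mem _ ht)
      rw [dslope_of_ne _ (sub_ne_zero.1 this), slope_def_field]
      ring
    rw [heq, intervalIntegral.integral_sub
      ((γ j).intervalIntegrable_mul_deriv (h := fun w => f w * (w - z)⁻¹)
        ((hfc j).mul (hinv j)))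
      (((γ j).intervalIntegrable_mul_deriv (hinv j)).const_mul _),
      intervalIntegral.integral_const_mul] at h0
    rw [sub_eq_zero.1 h0, Loop.index, mul_inv_cancel_left₀ Complex.two_pi_I_ne_zero]
    congr 1
    refine intervalIntegral.integral_congr fun t _ => ?_
    simp only [div_eq_mul_inv, mul_comm]
  rw [Finset.sum_congr rfl fun j _ => key j, ← Finset.mul_sum, ← Finset.mul_sum, hin z hz]
  ring

/-! ## Oriented boundaries of lemniscate domains -/

/-- A smooth closed curve, as a loop. -/
def Loop.ofContDiff (σ : ℝ → ℂ) (hσ : ContDiff ℝ 1 σ) {a b : ℝ} (hab : a < b) (h : σ a = σ b) :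
    Loop where
  a := a
  b := b
  lt := hab
  toFun := σ
  cont := hσ.continuous.continuousOn
  piecewise := ⟨∅, fun _ _ _ _ _ _ => hσ.contDiffOn⟩
  closed := h

/-- The variable speed `θ` is needed for the singular lemniscate, where a smooth lift exists only
after reparametrising the circle. -/
theorem integral_inv_sub_of_circle {R : ℝ} (hR : 0 < R) {θ : ℝ → ℝ} (hθ : ContDiff ℝ 1 θ)
    {t₀ t₁ : ℝ} (h₀ : θ t₀ = 0) (h₁ : θ t₁ = 2 * Real.pi) {ζ : ℂ} (hζ : ‖ζ‖ ≠ R) :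
    ∫ t in t₀..t₁, deriv (fun t => circleMap 0 R (θ t)) t * (circleMap 0 R (θ t) - ζ)⁻¹ =
      if ‖ζ‖ < R then 2 * Real.pi * Complex.I else 0 := by
  have hne : ∀ s, circleMap 0 R s - ζ ≠ 0 := fun s h0 => hζ (by
    rw [← sub_eq_zero.1 h0, norm_circleMap_zero, abs_of_pos hR])
  have hd : ∀ t, HasDerivAt θ (deriv θ t) t := fun t =>
    (hθ.differentiable one_ne_zero t).hasDerivAt
  have hcirc : ∮ z in C(0, R), (z - ζ)⁻¹ = if ‖ζ‖ < R then 2 * Real.pi * Complex.I else 0 := by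
    split_ifs with h
    · exact circleIntegral.integral_sub_inv_of_mem_ball (by simpa using h)
    · have hout : ∀ z ∈ closedBall (0 : ℂ) R, z - ζ ≠ 0 := fun z hz h0 => by
        rw [sub_eq_zero.1 h0, mem_closedBall_zero_iff] at hz
        exact h (lt_of_le_of_ne hz hζ)
      refine Complex.circleIntegral_eq_zero_of_differentiable_on_off_countable hR.le
        countable_empty (ContinuousOn.inv₀ (by fun_prop) hout) fun z hz => ?_
      exact DifferentiableAt.inv (by fun_prop) (hout z (ball_subset_closedBall hz.1))
  rw [← hcirc, circleIntegral, ← h₁, ← h₀,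
    ← intervalIntegral.integral_deriv_smul_comp (f := θ) (f' := deriv θ) (fun t _ => hd t)
      (hθ.continuous_deriv le_rfl).continuousOn]
  · refine intervalIntegral.integral_congr fun t _ => ?_
    have : deriv (fun t => circleMap 0 R (θ t)) t = deriv θ t • (circleMap 0 R (θ t) * Complex.I) :=
      ((hasDerivAt_circleMap 0 R (θ t)).scomp t (hd t)).deriv
    simp only [this, Function.comp, deriv_circleMap, smul_eq_mul, Complex.real_smul]
    ring
  · simp only [deriv_circleMap, smul_eq_mul]
    exact ((continuous_circleMap 0 R).mul continuous_const).mul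
      (((continuous_circleMap 0 R).sub continuous_const).inv₀ hne)

theorem exists_circleMap_eq {R : ℝ} (hR : 0 < R) {θ : ℝ → ℝ} (hθ : Continuous θ) {t₀ t₁ : ℝ}
    (hlt : t₀ < t₁) (h₀ : θ t₀ = 0) (h₁ : θ t₁ = 2 * Real.pi) {ζ : ℂ} (hζ : ‖ζ‖ = R) :
    ∃ t ∈ Icc t₀ t₁, circleMap 0 R (θ t) = ζ := by
  have : ζ ∈ circleMap 0 R '' Ioc 0 (2 * Real.pi) := by
    rw [image_circleMap_Ioc, abs_of_pos hR]; simpa using hζ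
  obtain ⟨φ, hφ, rfl⟩ := this
  have := intermediate_value_Icc hlt.le hθ.continuousOn
  rw [h₀, h₁] at this
  obtain ⟨t, ht, rfl⟩ := this (Ioc_subset_Icc_self hφ)
  exact ⟨t, ht, rfl⟩

section

variable {σ : ℝ → ℂ} {θ : ℝ → ℝ} {β : ℂ} {R t₀ t₁ : ℝ}

theorem continuous_deriv_div_sub (hσ : ContDiff ℝ 1 σ) {u : ℂ} (hu : ∀ t, σ t ≠ u) :
    Continuous fun t => deriv σ t / (σ t - u) :=
  (hσ.continuous_deriv le_rfl).div (hσ.continuous.sub continuous_const)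
    fun t => sub_ne_zero.2 (hu t)

/-- Up to sign, `(σ² + β) - (u² + β)` is the product `(σ - u)(-σ - u)`. Taking logarithmic
derivatives, the winding numbers of `σ` and `-σ` about `u` add up to that of the circle about `u² +
β`. -/
theorem integral_add_integral_neg (hR : 0 < R) (hσ : ContDiff ℝ 1 σ) (hθ : ContDiff ℝ 1 θ)
    (h₀ : θ t₀ = 0) (h₁ : θ t₁ = 2 * Real.pi)
    (hσθ : ∀ t, σ t ^ 2 + β = circleMap 0 R (θ t)) {u : ℂ} (hu : ‖u ^ 2 + β‖ ≠ R) :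
    (∫ t in t₀..t₁, deriv σ t / (σ t - u)) + (∫ t in t₀..t₁, -deriv σ t / (-σ t - u)) =
      if ‖u ^ 2 + β‖ < R then 2 * Real.pi * Complex.I else 0 := by
  have hsq : ∀ t, σ t ^ 2 ≠ u ^ 2 := fun t h => hu (by
    rw [← h, hσθ, norm_circleMap_zero, abs_of_pos hR])
  have hu1 : ∀ t, σ t ≠ u := fun t h => hsq t (by rw [h])
  have hu2 : ∀ t, (-σ) t ≠ u := fun t h => hsq t (by rw [← h, Pi.neg_apply, neg_sq])
  have hc2 : Continuous fun t => -deriv σ t / (-σ t - u) := by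
    have := continuous_deriv_div_sub hσ.neg hu2
    simpa [deriv.neg'] using this
  rw [← intervalIntegral.integral_add ((continuous_deriv_div_sub hσ hu1).intervalIntegrable _ _)
    (hc2.intervalIntegrable _ _), ← integral_inv_sub_of_circle hR hθ h₀ h₁ hu]
  refine intervalIntegral.integral_congr fun t _ => ?_
  have hd : deriv (fun t => circleMap 0 R (θ t)) t = 2 * σ t * deriv σ t := by
    simp_rw [← hσθ]
    have := ((hσ.differentiable one_ne_zero t).hasDerivAt.pow 2).add_const β
    simpa using this.deriv
  simp only [hd]
  rw [← hσθ]
  have e1 := sub_ne_zero.2 (hu1 t)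
  have e2 : -σ t - u ≠ 0 := sub_ne_zero.2 (hu2 t)
  have e3 : σ t ^ 2 + β - (u ^ 2 + β) = -((σ t - u) * (-σ t - u)) := by ring
  rw [div_add_div _ _ e1 e2, e3, ← div_eq_mul_inv, div_neg, ← neg_div]
  congr 1
  ring

/-- If `σ` is closed then `a ± σ` is the oriented boundary of the lemniscate domain. -/
theorem exists_isOrientedBoundary_of_closed (a : ℂ) (hR : 0 < R) (hσ : ContDiff ℝ 1 σ)
    (hθ : ContDiff ℝ 1 θ) (hlt : t₀ < t₁) (h₀ : θ t₀ = 0) (h₁ : θ t₁ = 2 * Real.pi)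
    (hσθ : ∀ t, σ t ^ 2 + β = circleMap 0 R (θ t)) (hcl : σ t₀ = σ t₁) :
    ∃ (n : ℕ) (γ : Fin n → Loop), IsOrientedBoundary γ {w | ‖(w - a) ^ 2 + β‖ < R} := by
  set γ₁ : Loop := Loop.ofContDiff (fun t => a + σ t) (contDiff_const.add hσ) hlt (by simp [hcl])
  set γ₂ : Loop := Loop.ofContDiff (fun t => a - σ t) (contDiff_const.sub hσ) hlt (by simp [hcl])
  have hindex : ∀ w, ‖(w - a) ^ 2 + β‖ ≠ R → ∑ j, (![γ₁, γ₂] j).index w =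
      if ‖(w - a) ^ 2 + β‖ < R then 1 else 0 := by
    intro w hw
    have := integral_add_integral_neg hR hσ hθ h₀ h₁ hσθ hw
    have hrw : ∑ j, (![γ₁, γ₂] j).index w = (2 * Real.pi * Complex.I)⁻¹ *
        ((∫ t in t₀..t₁, deriv σ t / (σ t - (w - a))) +
          ∫ t in t₀..t₁, -deriv σ t / (-σ t - (w - a))) := by
      rw [Fin.sum_univ_two, mul_add]
      congr 1
      · show (2 * Real.pi * Complex.I : ℂ)⁻¹ *
          (∫ t in t₀..t₁, deriv (fun t => a + σ t) t / (a + σ t - w)) = _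
        refine congrArg _ (intervalIntegral.integral_congr fun t _ => ?_)
        simp only [deriv_const_add']
        congr 1; ring
      · show (2 * Real.pi * Complex.I : ℂ)⁻¹ *
          (∫ t in t₀..t₁, deriv (fun t => a - σ t) t / (a - σ t - w)) = _
        refine congrArg _ (intervalIntegral.integral_congr fun t _ => ?_)
        simp only [deriv_const_sub]
        congr 1; ring
    rw [hrw, this]
    split_ifs
    · exact inv_mul_cancel₀ Complex.two_pi_I_ne_zero
    · rw [mul_zero]
  refine ⟨2, ![γ₁, γ₂], ?_, fun w hw => ?_, fun w hw => ?_⟩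
  · rw [frontier_lemniscate a β hR]
    ext w
    simp only [mem_iUnion, Fin.exists_fin_two, Matrix.cons_val_zero, Matrix.cons_val_one,
      mem_image]
    constructor
    · rintro (⟨t, -, rfl⟩ | ⟨t, -, rfl⟩)
      · show ‖(a + σ t - a) ^ 2 + β‖ = R
        rw [add_sub_cancel_left, hσθ, norm_circleMap_zero, abs_of_pos hR]
      · show ‖(a - σ t - a) ^ 2 + β‖ = R
        rw [sub_sub_cancel_left, neg_sq, hσθ, norm_circleMap_zero, abs_of_pos hR]
    · intro hw
      obtain ⟨t, ht, hte⟩ := exists_circleMap_eq hR hθ.continuous hlt h₀ h₁ hw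
      rw [← hσθ, add_left_inj] at hte
      rcases sq_eq_sq_iff_eq_or_eq_neg.1 hte with h | h
      · exact Or.inl ⟨t, ht, by show a + σ t = w; rw [h]; ring⟩
      · exact Or.inr ⟨t, ht, by show a - σ t = w; rw [h]; ring⟩
  · have hw : ‖(w - a) ^ 2 + β‖ < R := hw
    rw [hindex w hw.ne, if_pos hw]
  · rw [closure_lemniscate a β hR] at hw
    have hw : R < ‖(w - a) ^ 2 + β‖ := not_le.1 hw
    rw [hindex w hw.ne', if_neg hw.not_gt]

/-- If `σ` changes its sign after one turn of the circle then `a + σ`, taken over two turns, is the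
oriented boundary of the lemniscate domain. -/
theorem exists_isOrientedBoundary_of_antiperiodic (a : ℂ) (hR : 0 < R) (hσ : ContDiff ℝ 1 σ)
    (hσθ : ∀ t, σ t ^ 2 + β = circleMap 0 R t) (hanti : Function.Antiperiodic σ (2 * Real.pi)) :
    ∃ (n : ℕ) (γ : Fin n → Loop), IsOrientedBoundary γ {w | ‖(w - a) ^ 2 + β‖ < R} := by
  have hpi := Real.two_pi_pos
  have hcl : σ 0 = σ (2 * Real.pi + 2 * Real.pi) := by
    rw [hanti, ← zero_add (2 * Real.pi), hanti, neg_neg]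
  set γ : Loop := Loop.ofContDiff (fun t => a + σ t) (contDiff_const.add hσ)
    (a := 0) (b := 2 * Real.pi + 2 * Real.pi) (by linarith) (by simp only [hcl])
  have hindex : ∀ w, ‖(w - a) ^ 2 + β‖ ≠ R → ∑ j, ((fun _ : Fin 1 => γ) j).index w =
      if ‖(w - a) ^ 2 + β‖ < R then 1 else 0 := by
    intro w hw
    have hsum := integral_add_integral_neg (θ := id) hR hσ contDiff_id rfl rfl hσθ hw
    have hne : ∀ t, σ t ≠ w - a := fun t h => hw (by
      rw [← h, hσθ, norm_circleMap_zero, abs_of_pos hR])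
    have hc := continuous_deriv_div_sub hσ hne
    have hderiv : ∀ t, deriv σ (t + 2 * Real.pi) = -deriv σ t := fun t => by
      rw [← deriv_comp_add_const]
      have : (fun t => σ (t + 2 * Real.pi)) = fun t => -σ t := funext hanti
      rw [this, deriv.fun_neg]
    have hrw : ∑ j, ((fun _ : Fin 1 => γ) j).index w = (2 * Real.pi * Complex.I)⁻¹ *
        ((∫ t in (0 : ℝ)..(2 * Real.pi), deriv σ t / (σ t - (w - a))) +
          ∫ t in (0 : ℝ)..(2 * Real.pi), -deriv σ t / (-σ t - (w - a))) := by
      have h2 : ∫ t in (0 : ℝ)..(2 * Real.pi), -deriv σ t / (-σ t - (w - a)) =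
          ∫ t in (2 * Real.pi)..(2 * Real.pi + 2 * Real.pi), deriv σ t / (σ t - (w - a)) := by
        have := intervalIntegral.integral_comp_add_right (a := 0) (b := 2 * Real.pi)
          (fun t => deriv σ t / (σ t - (w - a))) (2 * Real.pi)
        rw [zero_add] at this
        rw [← this]
        refine intervalIntegral.integral_congr fun t _ => ?_
        simp only [hderiv, hanti t]
      rw [h2, intervalIntegral.integral_add_adjacent_intervals (hc.intervalIntegrable _ _)
        (hc.intervalIntegrable _ _), Fin.sum_univ_one, Loop.index]
      congr 1
      refine intervalIntegral.integral_congr fun t _ => ?_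
      simp only [γ, Loop.ofContDiff, deriv_const_add']
      congr 1; ring
    rw [hrw, hsum]
    split_ifs
    · exact inv_mul_cancel₀ Complex.two_pi_I_ne_zero
    · rw [mul_zero]
  refine ⟨1, fun _ => γ, ?_, fun w hw => ?_, fun w hw => ?_⟩
  · rw [frontier_lemniscate a β hR, iUnion_const]
    ext w
    constructor
    · rintro ⟨t, -, rfl⟩
      show ‖(a + σ t - a) ^ 2 + β‖ = R
      rw [add_sub_cancel_left, hσθ, norm_circleMap_zero, abs_of_pos hR]
    · intro hw
      obtain ⟨t, ht, hte⟩ := exists_circleMap_eq (θ := id) hR continuous_id hpi rfl rfl hw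
      rw [id_eq, ← hσθ, add_left_inj] at hte
      rcases sq_eq_sq_iff_eq_or_eq_neg.1 hte with h | h
      · exact ⟨t, ⟨ht.1, ht.2.trans (le_add_of_nonneg_left hpi.le)⟩, by show a + σ t = w; rw [h]; ring⟩
      · refine ⟨t + 2 * Real.pi, ⟨add_nonneg ht.1 hpi.le, ?_⟩, ?_⟩
        · show t + 2 * Real.pi ≤ 2 * Real.pi + 2 * Real.pi
          linarith [ht.2]
        · show a + σ (t + 2 * Real.pi) = w
          rw [hanti, h]; ring
  · have hw : ‖(w - a) ^ 2 + β‖ < R := hw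
    rw [hindex w hw.ne, if_pos hw]
  · rw [closure_lemniscate a β hR] at hw
    have hw : R < ‖(w - a) ^ 2 + β‖ := not_le.1 hw
    rw [hindex w hw.ne', if_neg hw.not_gt]

end

theorem contDiff_sqrt_comp {f : ℝ → ℂ} (hf : ContDiff ℝ 1 f) (h : ∀ t, f t ∈ Complex.slitPlane) :
    ContDiff ℝ 1 fun t => Complex.sqrt (f t) := by
  refine contDiff_iff_contDiffAt.2 fun t => ?_
  have hs : AnalyticAt ℂ Complex.sqrt (f t) :=
    Complex.differentiableOn_sqrt.analyticAt (Complex.isOpen_slitPlane.mem_nhds (h t))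
  exact (hs.contDiffAt.restrict_scalars ℝ).comp t hf.contDiffAt

theorem one_sub_mem_slitPlane {z : ℂ} (hz : ‖z‖ < 1) : 1 - z ∈ Complex.slitPlane := by
  refine Or.inl ?_
  have := (Complex.abs_re_le_norm z).trans_lt hz
  rw [Complex.sub_re, Complex.one_re]
  linarith [le_abs_self z.re]

/-- The rational parametrisation of the circle; it makes the square root explicit when `R = β`. -/
theorem exp_arctan_sq (s : ℝ) :
    Complex.exp (Real.arctan s * Complex.I) ^ 2 * (1 - s * Complex.I) = 1 + s * Complex.I := by
  have hcos : Real.cos (Real.arctan s) ^ 2 * (1 + s ^ 2) = 1 := by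
    rw [Real.cos_sq_arctan, div_mul_cancel₀ _ (by positivity)]
  have hsin : Real.sin (Real.arctan s) = s * Real.cos (Real.arctan s) := by
    rw [← Real.tan_mul_cos (Real.cos_arctan_pos s).ne', Real.tan_arctan]
  rw [Complex.exp_mul_I, ← Complex.ofReal_cos, ← Complex.ofReal_sin, hsin]
  have h : ((Real.cos (Real.arctan s) : ℝ) : ℂ) ^ 2 * (1 + (s : ℂ) ^ 2) = 1 := by
    exact_mod_cast hcos
  push_cast at h ⊢
  linear_combination (1 + s * Complex.I) * h -
    (Complex.cos (Complex.arctan s)) ^ 2 * (s : ℂ) ^ 2 * (1 + s * Complex.I) * Complex.I_sq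

theorem one_sub_mul_I_ne_zero (s : ℝ) : (1 : ℂ) - s * Complex.I ≠ 0 := fun h => by
  simpa using congrArg Complex.re h

/-- The lemniscate domain has an oriented boundary. -/
theorem exists_isOrientedBoundary (a : ℂ) {β R : ℝ} (hβ : 0 ≤ β) (hR : 0 < R) :
    ∃ (n : ℕ) (γ : Fin n → Loop), IsOrientedBoundary γ {w | ‖(w - a) ^ 2 + (β : ℂ)‖ < R} := by
  have hsqrt : ∀ {x : ℝ}, 0 ≤ x → ((√x : ℝ) : ℂ) ^ 2 = x := fun hx => by
    exact_mod_cast Real.sq_sqrt hx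
  rcases lt_trichotomy R β with hlt | rfl | hlt
  · have hβ0 : (β : ℂ) ≠ 0 := by exact_mod_cast (hR.trans hlt).ne'
    -- Two ovals: `R e^{it} - β = -β (1 - (R/β) e^{it})`, where the last factor stays in the right
    -- half-plane, so its principal root is smooth and closes up.
    refine exists_isOrientedBoundary_of_closed (t₀ := 0) (t₁ := 2 * Real.pi) (θ := id)
      (σ := fun t => Complex.I * √β * Complex.sqrt (1 - circleMap 0 (R / β) t)) a hR
      (contDiff_const.mul (contDiff_sqrt_comp
        (contDiff_const.sub (contDiff_circleMap _ _)) fun t => one_sub_mem_slitPlane ?_))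
      contDiff_id Real.two_pi_pos rfl rfl (fun t => ?_) ?_
    · rw [norm_circleMap_zero, abs_of_pos (div_pos hR (hR.trans hlt))]
      exact (div_lt_one (hR.trans hlt)).2 hlt
    · rw [mul_pow, mul_pow, sqrt_pow_two, hsqrt hβ, Complex.I_sq, circleMap_zero, circleMap_zero]
      rw [id_eq]
      push_cast
      generalize Complex.exp (t * Complex.I) = x
      field_simp
      ring
    · have := periodic_circleMap 0 (R / β) 0
      rw [zero_add] at this
      simp only [this]
  -- Figure eight: with `s = sin t` and this `θ`, `e^{iθ} = -((1 + is)/(1 - is))²`, hence `e^{iθ} -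
  -- 1 = -2 cos² t / (1 - is)²`, which has a smooth root vanishing at both ends.
  · refine exists_isOrientedBoundary_of_closed (t₀ := -(Real.pi / 2)) (t₁ := Real.pi / 2)
      (θ := fun t => 4 * Real.arctan (Real.sin t) + Real.pi)
      (σ := fun t => Complex.I * √R * (√2 * ((Real.cos t : ℝ) : ℂ) / (1 - ((Real.sin t : ℝ) : ℂ) * Complex.I)))
      a hR ?_ ?_ (by linarith [Real.pi_pos]) ?_ ?_ (fun t => ?_) ?_
    · have hs : ContDiff ℝ 1 fun t : ℝ => ((Real.sin t : ℝ) : ℂ) :=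
        Complex.ofRealCLM.contDiff.comp Real.contDiff_sin
      have hc : ContDiff ℝ 1 fun t : ℝ => ((Real.cos t : ℝ) : ℂ) :=
        Complex.ofRealCLM.contDiff.comp Real.contDiff_cos
      exact contDiff_const.mul ((contDiff_const.mul hc).mul
        ((contDiff_const.sub (hs.mul contDiff_const)).inv fun t => one_sub_mul_I_ne_zero _))
    · exact (contDiff_const.mul Real.contDiff_sin.arctan).add contDiff_const
    · simp [Real.arctan_neg]; ring
    · simp; ring
    · have h := exp_arctan_sq (Real.sin t)
      have hne := one_sub_mul_I_ne_zero (Real.sin t)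
      have hsc : ((Real.sin t : ℝ) : ℂ) ^ 2 + ((Real.cos t : ℝ) : ℂ) ^ 2 = 1 := by
        exact_mod_cast Real.sin_sq_add_cos_sq t
      have hexp : Complex.exp (((4 * Real.arctan (Real.sin t) + Real.pi : ℝ) : ℂ) * Complex.I) =
          -(Complex.exp (Real.arctan (Real.sin t) * Complex.I) ^ 2) ^ 2 := by
        rw [← pow_mul, ← Complex.exp_nat_mul]
        push_cast
        rw [add_mul, Complex.exp_add, Complex.exp_pi_mul_I]
        ring_nf
      rw [circleMap_zero, hexp, eq_div_of_mul_eq hne h, mul_pow, mul_pow, div_pow, mul_pow,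
        hsqrt hR.le, hsqrt zero_le_two, Complex.I_sq]
      generalize ((Real.sin t : ℝ) : ℂ) = s at *
      generalize ((Real.cos t : ℝ) : ℂ) = k at *
      have hk : k ^ 2 = 1 - s ^ 2 := by linear_combination hsc
      rw [hk]
      field_simp
      push_cast
      linear_combination 2 * R * s ^ 2 * Complex.I_sq
    · simp
  · have hR0 : (R : ℂ) ≠ 0 := by exact_mod_cast hR.ne'
    -- One curve: `R e^{it} - β = R e^{it} (1 - (β/R) e^{-it})`. The root of the last factor is
    -- periodic, and `e^{it/2}` changes sign after one turn.
    refine exists_isOrientedBoundary_of_antiperiodic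
      (σ := fun t => circleMap 0 (√R) (t / 2) * Complex.sqrt (1 - circleMap 0 (β / R) (-t))) a hR
      (ContDiff.mul ((contDiff_circleMap _ _).comp (contDiff_id.div_const 2)) (contDiff_sqrt_comp
        (contDiff_const.sub ((contDiff_circleMap _ _).comp contDiff_neg))
          fun t => one_sub_mem_slitPlane ?_))
      (fun t => ?_) (fun t => ?_)
    · rw [norm_circleMap_zero, abs_of_nonneg (by positivity)]
      exact (div_lt_one hR).2 hlt
    · have h1 : Complex.exp (((t / 2 : ℝ) : ℂ) * Complex.I) ^ 2 = Complex.exp (t * Complex.I) := by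
        rw [← Complex.exp_nat_mul]; push_cast; ring_nf
      have h2 : Complex.exp (t * Complex.I) * Complex.exp (((-t : ℝ) : ℂ) * Complex.I) = 1 := by
        rw [← Complex.exp_add]; push_cast; simp
      rw [mul_pow, sqrt_pow_two, circleMap_zero, circleMap_zero, circleMap_zero, mul_pow, h1,
        hsqrt hR.le]
      generalize Complex.exp (((-t : ℝ) : ℂ) * Complex.I) = y at *
      push_cast
      field_simp
      linear_combination (-(β : ℂ)) * h2
    · have h1 : circleMap 0 (√R) ((t + 2 * Real.pi) / 2) = -circleMap 0 (√R) (t / 2) := by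
        rw [circleMap_zero, circleMap_zero]
        have : (((t + 2 * Real.pi) / 2 : ℝ) : ℂ) * Complex.I =
            ((t / 2 : ℝ) : ℂ) * Complex.I + Real.pi * Complex.I := by push_cast; ring
        rw [this, Complex.exp_add, Complex.exp_pi_mul_I]; ring
      have h2 : circleMap 0 (β / R) (-(t + 2 * Real.pi)) = circleMap 0 (β / R) (-t) := by
        rw [neg_add, ← sub_eq_add_neg]
        exact (periodic_circleMap 0 (β / R)).sub_eq _
      simp only [h1, h2, neg_mul]

end SkewAnalysis

namespace SkewAnalysis

/-! ## Orbits -/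

theorem mul_eq_conj_mul {g : ℍ[ℝ]} (hg : g ≠ 0) (q : ℍ[ℝ]) : g * q = conj g q * g := by
  rw [conj, inv_mul_cancel_right₀ hg]

theorem eq_conj_of_mul_eq {g q x : ℍ[ℝ]} (hg : g ≠ 0) (h : g * q = x * g) : x = conj g q := by
  rw [conj, h, mul_inv_cancel_right₀ hg]

theorem re_conj {g : ℍ[ℝ]} (hg : g ≠ 0) (q : ℍ[ℝ]) : (conj g q).re = q.re := by
  have : (g * q * g⁻¹).re = (g⁻¹ * (g * q)).re := by simp only [Quaternion.re_mul]; ring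
  rw [conj, this, inv_mul_cancel_left₀ hg]

theorem norm_conj {g : ℍ[ℝ]} (hg : g ≠ 0) (q : ℍ[ℝ]) : ‖conj g q‖ = ‖q‖ := by
  rw [conj, norm_mul, norm_mul, norm_inv, mul_right_comm, mul_inv_cancel₀ (norm_ne_zero_iff.2 hg),
    one_mul]

theorem coe_norm_sq (q : ℍ[ℝ]) : ((‖q‖ ^ 2 : ℝ) : ℍ[ℝ]) = star q * q := by
  rw [Quaternion.star_mul_self, Quaternion.normSq_eq_norm_mul_self, sq]

/-- The basic identity for two points of the same orbit. -/
theorem sub_mul_eq_star_mul_sub {x q : ℍ[ℝ]} (hre : x.re = q.re) (hn : ‖x‖ = ‖q‖) :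
    (x - q) * x = star q * (x - q) := by
  have hs : star x * x = star q * q := by rw [← coe_norm_sq, ← coe_norm_sq, hn]
  have hx : star q + q = star x + x := by
    rw [Quaternion.star_add_self, Quaternion.star_add_self, hre]
  have hx' : star x = star q + q - x := eq_sub_of_add_eq hx.symm
  rw [hx'] at hs
  have hcomm : x * x = (star q + q) * x - star q * q := by rw [← hs]; noncomm_ring
  rw [sub_mul, mul_sub, hcomm]
  noncomm_ring

theorem exists_quaternion_eq (a b c d : ℝ) :
    ∃ g : ℍ[ℝ], g.re = a ∧ g.imI = b ∧ g.imJ = c ∧ g.imK = d :=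
  ⟨⟨a, b, c, d⟩, rfl, rfl, rfl, rfl⟩

/-- The witness is purely imaginary and orthogonal to the imaginary part of `q`, hence anticommutes
with it. It serves the case in which the conjugator `q - star x` of `mem_orbit_iff` vanishes. -/
theorem exists_mul_eq_star_mul (q : ℍ[ℝ]) : ∃ g : ℍ[ℝ], g ≠ 0 ∧ g * q = star q * g := by
  by_cases h : q.imI = 0 ∧ q.imJ = 0
  · obtain ⟨g, h0, h1, h2, h3⟩ := exists_quaternion_eq 0 1 0 0
    refine ⟨g, fun hg => ?_, ?_⟩
    · simp [hg] at h1
    · apply Quaternion.ext <;> simp [h.1, h.2, h0, h1, h2, h3]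
  · obtain ⟨g, h0, h1, h2, h3⟩ := exists_quaternion_eq 0 (-q.imJ) q.imI 0
    refine ⟨g, fun hg => h ?_, ?_⟩
    · subst hg
      simp only [Quaternion.imI_zero, Quaternion.imJ_zero] at h1 h2
      exact ⟨h2.symm, neg_eq_zero.1 h1.symm⟩
    · apply Quaternion.ext <;> simp [h0, h1, h2, h3] <;> ring

theorem mem_orbit_iff {x q : ℍ[ℝ]} : x ∈ orbit q ↔ x.re = q.re ∧ ‖x‖ = ‖q‖ := by
  constructor
  · rintro ⟨g, hg, rfl⟩
    exact ⟨re_conj hg q, norm_conj hg q⟩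
  · rintro ⟨hre, hn⟩
    by_cases h : q = star x
    · obtain ⟨g, hg, hgq⟩ := exists_mul_eq_star_mul q
      refine ⟨g, hg, eq_conj_of_mul_eq hg ?_⟩
      rw [hgq, h, star_star]
    · have := sub_mul_eq_star_mul_sub (x := q) (q := star x) (by simp [hre]) (by simp [hn])
      rw [star_star] at this
      exact ⟨q - star x, sub_ne_zero.2 h, eq_conj_of_mul_eq (sub_ne_zero.2 h) this⟩

theorem self_mem_orbit (q : ℍ[ℝ]) : q ∈ orbit q := mem_orbit_iff.2 ⟨rfl, rfl⟩

theorem orbit_eq_of_mem {x q : ℍ[ℝ]} (h : x ∈ orbit q) : orbit x = orbit q := by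
  rw [mem_orbit_iff] at h
  ext y
  rw [mem_orbit_iff, mem_orbit_iff, h.1, h.2]

theorem conj_mem_orbit {g x q : ℍ[ℝ]} (hg : g ≠ 0) (h : x ∈ orbit q) : conj g x ∈ orbit q := by
  rw [← orbit_eq_of_mem h]
  exact ⟨g, hg, rfl⟩

theorem IsRegion.orbit_subset {U : Set ℍ[ℝ]} (hU : IsRegion U) {q : ℍ[ℝ]} (hq : q ∈ U) :
    orbit q ⊆ U := by
  rintro x ⟨g, hg, rfl⟩
  exact hU.2 g hg q hq

theorem orbit_coe_subsingleton (r : ℝ) : (orbit (r : ℍ[ℝ])).Subsingleton := by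
  rintro x ⟨g, hg, rfl⟩ y ⟨h, hh, rfl⟩
  rw [conj, conj, ← Quaternion.coe_commutes, ← Quaternion.coe_commutes,
    mul_inv_cancel_right₀ hg, mul_inv_cancel_right₀ hh]

/-! ## The quadratic polynomial with the root `p` -/

/-- The quadratic real polynomial with the root `p`. -/
def quadPoly (p q : ℍ[ℝ]) : ℍ[ℝ] :=
  q ^ 2 - ((2 * p.re : ℝ) : ℍ[ℝ]) * q + ((‖p‖ ^ 2 : ℝ) : ℍ[ℝ])

theorem orbitPoly_eq_quadPoly {p : ℍ[ℝ]} (hp : (orbit p).Nontrivial) (q : ℍ[ℝ]) :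
    orbitPoly p q = quadPoly p q := by
  rw [orbitPoly, if_pos hp, quadPoly]

/-- The operator `h ↦ q h - h p` governs everything here: its nonzero kernel elements conjugate `p`
to `q`, and the Cauchy kernel solves `q h - h p = 1`. -/
theorem quadPoly_eq (p q : ℍ[ℝ]) : quadPoly p q = q * (q - star p) - (q - star p) * p := by
  have h : ((2 * p.re : ℝ) : ℍ[ℝ]) * q = q * (p + star p) := by
    rw [Quaternion.coe_commutes, Quaternion.self_add_star']
  rw [quadPoly, h, coe_norm_sq]
  noncomm_ring

theorem commute_quadPoly (p q : ℍ[ℝ]) : Commute (quadPoly p q) q := by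
  have h : ∀ r : ℝ, Commute (r : ℍ[ℝ]) q := fun r => Quaternion.coe_commutes r q
  exact (((Commute.refl q).pow_left 2).sub_left ((h _).mul_left (Commute.refl q))).add_left (h _)

theorem quadPoly_conj (p : ℍ[ℝ]) {g : ℍ[ℝ]} (hg : g ≠ 0) (q : ℍ[ℝ]) :
    quadPoly p (conj g q) = conj g (quadPoly p q) := by
  refine eq_conj_of_mul_eq hg ?_
  have h1 := mul_eq_conj_mul hg q
  have h2 : g * q ^ 2 = conj g q ^ 2 * g := by
    rw [sq, sq, ← mul_assoc, h1, mul_assoc, h1, mul_assoc]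
  rw [quadPoly, quadPoly, mul_add, mul_sub, h2, ← mul_assoc, ← Quaternion.coe_commutes, mul_assoc,
    h1, ← Quaternion.coe_commutes]
  noncomm_ring

theorem mem_orbit_of_mul_eq {p y h : ℍ[ℝ]} (hh : h ≠ 0) (he : y * h = h * p) : y ∈ orbit p :=
  ⟨h, hh, eq_conj_of_mul_eq hh he.symm⟩

theorem quadPoly_ne_zero {p y : ℍ[ℝ]} (hy : y ∉ orbit p) : quadPoly p y ≠ 0 := by
  intro h0
  rw [quadPoly_eq, sub_eq_zero] at h0
  by_cases hyp : y = star p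
  · exact hy (mem_orbit_iff.2 ⟨by simp [hyp], by simp [hyp]⟩)
  · exact hy (mem_orbit_of_mul_eq (sub_ne_zero.2 hyp) h0)

theorem norm_orbitPoly_eq_of_mem {c x p : ℍ[ℝ]} (hc : (orbit c).Nontrivial) (h : x ∈ orbit p) :
    ‖orbitPoly c x‖ = ‖orbitPoly c p‖ := by
  obtain ⟨g, hg, rfl⟩ := h
  rw [orbitPoly_eq_quadPoly hc, orbitPoly_eq_quadPoly hc, quadPoly_conj c hg, norm_conj hg]

/-! ## The Cauchy kernel -/

theorem isRightSkewInverseOn_sub (p : ℍ[ℝ]) :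
    IsRightSkewInverseOn (orbit p)ᶜ (fun q => q - p)
      fun q => (quadPoly p q)⁻¹ * (q - star p) := by
  intro x hx
  have hxp : x - p ≠ 0 := fun h => hx (sub_eq_zero.1 h ▸ self_mem_orbit p)
  have hP := quadPoly_ne_zero hx
  constructor
  · set g := (x - p)⁻¹ with hg
    have hg0 : g ≠ 0 := inv_ne_zero hxp
    have hxg : x - p = g⁻¹ := (inv_inv _).symm
    -- Since `g⁻¹ = x - p`, the left side is `x (x - p) - (x - p) p̄`.
    have e : g⁻¹ * (conj g x - star p) = quadPoly p x := by
      rw [← hxg, mul_sub, quadPoly_eq, conj, hxg, mul_assoc, inv_mul_cancel_left₀ hg0, ← hxg]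
      have : star p = ((2 * p.re : ℝ) : ℍ[ℝ]) - p := Quaternion.star_eq_two_re_sub p
      rw [this, mul_sub, mul_sub, sub_mul, sub_mul, sub_mul, mul_sub,
        ← Quaternion.coe_commutes (2 * p.re) p]
      noncomm_ring
    have e' : conj g x - star p = g * quadPoly p x := by rw [← e, mul_inv_cancel_left₀ hg0]
    have hP' : conj g (quadPoly p x) ≠ 0 := by
      rw [← quadPoly_conj p hg0]
      exact quadPoly_ne_zero fun h => hx (orbit_eq_of_mem h ▸
        mem_orbit_iff.2 ⟨(re_conj hg0 x).symm, (norm_conj hg0 x).symm⟩)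
    rw [rightSkewMul, if_neg hxp]
    show (x - p) * ((quadPoly p (conj g x))⁻¹ * (conj g x - star p)) = 1
    rw [e', quadPoly_conj p hg0, mul_eq_conj_mul hg0, inv_mul_cancel_left₀ hP', hg,
      mul_inv_cancel₀ hxp]
  · have hx' : x - star p ≠ 0 := fun h => hx (mem_orbit_iff.2
      ⟨by simp [sub_eq_zero.1 h], by simp [sub_eq_zero.1 h]⟩)
    obtain ⟨g, hg⟩ : ∃ g, g = (quadPoly p x)⁻¹ * (x - star p) := ⟨_, rfl⟩
    have hg0 : g ≠ 0 := hg ▸ mul_ne_zero (inv_ne_zero hP) hx'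
    have hr : rightSkewMul (fun q => (quadPoly p q)⁻¹ * (q - star p)) (fun q => q - p) x =
        g * (conj g⁻¹ x - p) := by
      subst hg
      exact if_neg hg0
    rw [hr, mul_sub, conj, inv_inv, ← mul_assoc, ← mul_assoc,
      mul_inv_cancel₀ hg0, one_mul, hg, ← mul_assoc, ← ((commute_quadPoly p x).inv_left₀).eq,
      mul_assoc, mul_assoc, ← mul_sub, ← quadPoly_eq, inv_mul_cancel₀ hP]

/-- The kernel is some chosen inverse, so uniqueness is what matters. Every inverse satisfies `y G -
G p = 1` at `y`; the difference `h` of two solutions has `y h = h p`, and `h ≠ 0` would put `y` in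
the orbit of `p`. -/
theorem cauchyKernel_eq {p y : ℍ[ℝ]} (hy : y ∉ orbit p) :
    cauchyKernel p y = (quadPoly p y)⁻¹ * (y - star p) := by
  have key : ∀ {G : ℍ[ℝ] → ℍ[ℝ]}, IsRightSkewInverseOn (orbit p)ᶜ (fun q => q - p) G →
      y * G y - G y * p = 1 := by
    intro G hG
    have h := (hG y hy).2
    rw [rightSkewMul] at h
    by_cases h0 : G y = 0
    · rw [if_pos h0] at h
      exact absurd h zero_ne_one
    · rwa [if_neg h0, mul_sub, conj, inv_inv, ← mul_assoc, ← mul_assoc, mul_inv_cancel₀ h0,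
        one_mul] at h
  have h1 := key (Classical.epsilon_spec ⟨_, isRightSkewInverseOn_sub p⟩)
  have h2 := key (isRightSkewInverseOn_sub p)
  by_contra hne
  refine hy (mem_orbit_of_mul_eq (sub_ne_zero.2 hne) (sub_eq_zero.1 ?_))
  rw [mul_sub, sub_mul, sub_sub_sub_comm]
  exact sub_eq_zero.2 (h1.trans h2.symm)

/-! ## Skew regular functions on an orbit -/

/-- For `x ≠ y` in one orbit, conjugation by `x - y` sends `x` to `ȳ`. So `D ⋄ (T - y)` samples `D`
only at `ȳ`, and the difference quotient does not depend on `x`. By symmetry it does not depend on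
`y` either. -/
theorem exists_orbital_const {U : Set ℍ[ℝ]} (hU : IsRegion U) {F : ℍ[ℝ] → ℍ[ℝ]}
    (hF : SkewRegularOn U F) {q : ℍ[ℝ]} (hq : q ∈ U) :
    ∃ C : ℍ[ℝ], ∀ x ∈ orbit q, ∀ y ∈ orbit q, F x - F y = C * (x - y) := by
  have hquot : ∀ y ∈ orbit q, ∃ C : ℍ[ℝ], ∀ x ∈ orbit q, F x - F y = C * (x - y) := by
    intro y hy
    obtain ⟨D, -, hD⟩ := hF y (hU.orbit_subset hq hy)
    refine ⟨D (star y), fun x hx => ?_⟩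
    rw [hD x (hU.orbit_subset hq hx), add_sub_cancel_left, skewMul]
    split_ifs with h
    · rw [h, mul_zero]
    · rw [mem_orbit_iff] at hx hy
      rw [← eq_conj_of_mul_eq h
        (sub_mul_eq_star_mul_sub (hx.1.trans hy.1.symm) (hx.2.trans hy.2.symm))]
  choose! C hC using hquot
  refine ⟨C q, fun x hx y hy => ?_⟩
  have hsymm : ∀ u ∈ orbit q, ∀ v ∈ orbit q, u ≠ v → C u = C v := by
    intro u hu v hv huv
    have h1 := hC u hu v hv
    have h2 := hC v hv u hu
    refine mul_right_cancel₀ (sub_ne_zero.2 huv) ?_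
    rw [← h2, ← neg_sub v u, mul_neg, ← h1, neg_sub]
  rw [hC y hy x hx]
  by_cases hyq : y = q
  · rw [hyq]
  · rw [hsymm y hy q (self_mem_orbit q) hyq]

/-- If `F(x) = A + C x` on the orbit, then `(F ⋄ a)(x) = A a + C a x`, which is additive in `a`. -/
theorem skewConvexOn_of_affine {F : ℍ[ℝ] → ℍ[ℝ]} {q C : ℍ[ℝ]}
    (hF : ∀ x ∈ orbit q, ∀ y ∈ orbit q, F x - F y = C * (x - y)) :
    SkewConvexOn (orbit q) F := by
  have key : ∀ a : ℍ[ℝ], ∀ x ∈ orbit q,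
      skewMul F (fun _ => a) x = (F q - C * q) * a + C * a * x := by
    intro a x hx
    rw [skewMul]
    split_ifs with h
    · simp [h]
    · have := hF _ (conj_mem_orbit h hx) q (self_mem_orbit q)
      rw [eq_add_of_sub_eq this, mul_sub, add_mul, sub_mul, mul_assoc C, ← mul_eq_conj_mul h]
      noncomm_ring
  intro a b x hx
  rw [key _ x hx, key _ x hx, key _ x hx]
  noncomm_ring

open Set Filter Topology MeasureTheory Metric

/-! ## The plane `ℝ + ℝ I` -/

theorem re_eq_zero_of_sq {I : ℍ[ℝ]} (hI : I ^ 2 = -1) : I.re = 0 := by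
  rw [sq] at hI
  have h0 := congrArg QuaternionAlgebra.re hI
  have h1 := congrArg QuaternionAlgebra.imI hI
  have h2 := congrArg QuaternionAlgebra.imJ hI
  have h3 := congrArg QuaternionAlgebra.imK hI
  simp only [Quaternion.re_mul, Quaternion.imI_mul, Quaternion.imJ_mul, Quaternion.imK_mul,
    Quaternion.re_neg, Quaternion.imI_neg, Quaternion.imJ_neg, Quaternion.imK_neg,
    Quaternion.re_one, Quaternion.imI_one, Quaternion.imJ_one, Quaternion.imK_one] at h0 h1 h2 h3
  by_contra hne
  have e1 : I.imI = 0 := by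
    have : I.re * I.imI = 0 := by linarith
    exact (mul_eq_zero.1 this).resolve_left hne
  have e2 : I.imJ = 0 := by
    have : I.re * I.imJ = 0 := by linarith
    exact (mul_eq_zero.1 this).resolve_left hne
  have e3 : I.imK = 0 := by
    have : I.re * I.imK = 0 := by linarith
    exact (mul_eq_zero.1 this).resolve_left hne
  rw [e1, e2, e3] at h0
  nlinarith [mul_self_nonneg I.re]

/-- The identification of `ℂ` with `ℝ + ℝ I`, as a homomorphism of algebras. -/
def sliceHom (I : ℍ[ℝ]) (hI : I ^ 2 = -1) : ℂ →ₐ[ℝ] ℍ[ℝ] :=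
  Complex.liftAux I (by rw [← sq, hI])

theorem sliceHom_apply {I : ℍ[ℝ]} (hI : I ^ 2 = -1) (z : ℂ) : sliceHom I hI z = sliceEmb I z := by
  rw [sliceHom, Complex.liftAux_apply, sliceEmb, ← Quaternion.coe_mul_eq_smul]
  rfl

theorem sliceHom_I {I : ℍ[ℝ]} (hI : I ^ 2 = -1) : sliceHom I hI Complex.I = I := by
  simp [sliceHom]

theorem sliceHom_ofReal {I : ℍ[ℝ]} (hI : I ^ 2 = -1) (x : ℝ) : sliceHom I hI x = (x : ℍ[ℝ]) := by
  exact (sliceHom I hI).commutes x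

theorem re_sliceHom {I : ℍ[ℝ]} (hI : I ^ 2 = -1) (z : ℂ) : (sliceHom I hI z).re = z.re := by
  simp [sliceHom_apply, sliceEmb, re_eq_zero_of_sq hI]

theorem star_sliceHom {I : ℍ[ℝ]} (hI : I ^ 2 = -1) (z : ℂ) :
    star (sliceHom I hI z) = sliceHom I hI (starRingEnd ℂ z) := by
  have hs : star I = -I := by
    rw [Quaternion.star_eq_two_re_sub, re_eq_zero_of_sq hI]; simp
  simp only [sliceHom_apply, sliceEmb, star_add, star_mul, Quaternion.star_coe, hs, Complex.conj_re,
    Complex.conj_im, Quaternion.coe_neg, neg_mul, Quaternion.coe_commutes]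

theorem norm_sliceHom {I : ℍ[ℝ]} (hI : I ^ 2 = -1) (z : ℂ) : ‖sliceHom I hI z‖ = ‖z‖ := by
  rw [← sq_eq_sq₀ (norm_nonneg _) (norm_nonneg _)]
  have h := coe_norm_sq (sliceHom I hI z)
  rw [star_sliceHom, ← map_mul, mul_comm, Complex.mul_conj, sliceHom_ofReal,
    Quaternion.coe_inj] at h
  rw [h, Complex.normSq_eq_norm_sq]

/-- `sliceHom` as a continuous linear map. -/
def sliceCLM (I : ℍ[ℝ]) (hI : I ^ 2 = -1) : ℂ →L[ℝ] ℍ[ℝ] :=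
  (sliceHom I hI).toLinearMap.toContinuousLinearMap

theorem continuous_sliceHom {I : ℍ[ℝ]} (hI : I ^ 2 = -1) : Continuous (sliceHom I hI) :=
  (sliceCLM I hI).continuous

/-- The projection `h ↦ Re h - i Re (h I)`, which is linear for the right multiplication by
elements of `ℝ + ℝ I`. -/
def sliceProj (I : ℍ[ℝ]) : ℍ[ℝ] →L[ℝ] ℂ :=
  LinearMap.toContinuousLinearMap
    { toFun := fun h => ⟨h.re, -(h * I).re⟩
      map_add' := fun x y => by
        apply Complex.ext
        · simp
        · simp only [add_mul, Quaternion.re_add, Complex.add_im]; ring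
      map_smul' := fun r x => by
        apply Complex.ext
        · simp
        · simp only [smul_mul_assoc, Quaternion.re_smul, RingHom.id_apply, Complex.smul_im,
            smul_eq_mul]
          ring }

theorem sliceProj_apply (I h : ℍ[ℝ]) : sliceProj I h = ⟨h.re, -(h * I).re⟩ := rfl

theorem sliceProj_mul {I : ℍ[ℝ]} (hI : I ^ 2 = -1) (h : ℍ[ℝ]) (w : ℂ) :
    sliceProj I (h * sliceHom I hI w) = sliceProj I h * w := by
  have e1 : h * sliceHom I hI w = w.re • h + w.im • (h * I) := by
    rw [sliceHom_apply, sliceEmb, mul_add, Quaternion.mul_coe_eq_smul, ← mul_assoc,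
      ← Quaternion.coe_commutes, mul_assoc, Quaternion.coe_mul_eq_smul]
  have e2 : sliceProj I (h * I) = sliceProj I h * Complex.I := by
    rw [sliceProj_apply, sliceProj_apply, mul_assoc, ← sq, hI]
    apply Complex.ext <;> simp
  rw [e1, map_add, map_smul, map_smul, e2, Complex.real_smul, Complex.real_smul]
  nth_rewrite 3 [← Complex.re_add_im w]
  ring

theorem sliceProj_sliceHom {I : ℍ[ℝ]} (hI : I ^ 2 = -1) (w : ℂ) :
    sliceProj I (sliceHom I hI w) = w := by
  have h1 : sliceProj I 1 = 1 := by
    rw [sliceProj_apply, one_mul, re_eq_zero_of_sq hI]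
    apply Complex.ext <;> simp
  rw [← one_mul (sliceHom I hI w), sliceProj_mul, h1, one_mul]

/-- The projection alone loses half of the coordinates. Left factors `k` recover them: `k = star (x
- y)` yields `|x - y|²`. Complex results thus transfer to quaternion-valued functions. -/
theorem eq_of_sliceProj_eq {I x y : ℍ[ℝ]}
    (h : ∀ k : ℍ[ℝ], sliceProj I (k * x) = sliceProj I (k * y)) : x = y := by
  have h1 := h (star (x - y))
  rw [← sub_eq_zero, ← map_sub, ← mul_sub, Quaternion.star_mul_self] at h1
  have h2 := congrArg Complex.re h1
  rw [sliceProj_apply] at h2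
  exact sub_eq_zero.1 (Quaternion.normSq_eq_zero.1 (by simpa using h2))

theorem deriv_sliceHom_comp {I : ℍ[ℝ]} (hI : I ^ 2 = -1) (f : ℝ → ℂ) (t : ℝ) :
    deriv (fun t => sliceHom I hI (f t)) t = sliceHom I hI (deriv f t) := by
  by_cases hf : DifferentiableAt ℝ f t
  · exact ((sliceCLM I hI).hasFDerivAt.comp_hasDerivAt t hf.hasDerivAt).deriv
  -- At break points both derivatives take the default value zero, because `sliceProj` is a linear
  -- left inverse.
  · have hf' : ¬ DifferentiableAt ℝ (fun t => sliceHom I hI (f t)) t := fun h => hf (by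
      have := (sliceProj I).differentiableAt.comp t h
      simpa only [Function.comp_def, sliceProj_sliceHom] using this)
    rw [deriv_zero_of_not_differentiableAt hf, deriv_zero_of_not_differentiableAt hf', map_zero]

theorem re_sq_le_norm_sq (c : ℍ[ℝ]) : c.re ^ 2 ≤ ‖c‖ ^ 2 := by
  have := Quaternion.normSq_def' c
  rw [Quaternion.normSq_eq_norm_mul_self] at this
  nlinarith [sq_nonneg c.imI, sq_nonneg c.imJ, sq_nonneg c.imK]

/-- Each orbit meets `ℝ + ℝ I`. -/
theorem exists_sliceHom_mem_orbit {I : ℍ[ℝ]} (hI : I ^ 2 = -1) (p : ℍ[ℝ]) :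
    ∃ z : ℂ, sliceHom I hI z ∈ orbit p := by
  have hle := re_sq_le_norm_sq p
  refine ⟨⟨p.re, √(‖p‖ ^ 2 - p.re ^ 2)⟩, mem_orbit_iff.2 ⟨re_sliceHom hI _, ?_⟩⟩
  rw [norm_sliceHom, ← sq_eq_sq₀ (norm_nonneg _) (norm_nonneg _), ← Complex.normSq_eq_norm_sq,
    Complex.normSq_mk, Real.mul_self_sqrt (sub_nonneg.2 hle)]
  ring

theorem sliceHom_conj_mem_orbit {I : ℍ[ℝ]} (hI : I ^ 2 = -1) {p : ℍ[ℝ]} {z : ℂ}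
    (h : sliceHom I hI z ∈ orbit p) : sliceHom I hI (starRingEnd ℂ z) ∈ orbit p := by
  rw [mem_orbit_iff] at h ⊢
  rwa [← star_sliceHom, norm_star, Quaternion.re_star]

theorem quadPoly_sliceHom {I : ℍ[ℝ]} (hI : I ^ 2 = -1) {p : ℍ[ℝ]} {z : ℂ}
    (h : sliceHom I hI z ∈ orbit p) (w : ℂ) :
    quadPoly p (sliceHom I hI w) = sliceHom I hI ((w - z) * (w - starRingEnd ℂ z)) := by
  rw [mem_orbit_iff, re_sliceHom, norm_sliceHom] at h
  have e : (w - z) * (w - starRingEnd ℂ z) = w ^ 2 - ((2 * z.re : ℝ) : ℂ) * w +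
      ((‖z‖ ^ 2 : ℝ) : ℂ) := by
    have h1 := Complex.add_conj z
    have h2 := Complex.mul_conj z
    rw [Complex.normSq_eq_norm_sq] at h2
    rw [← h1, ← h2]
    ring
  rw [e, quadPoly, ← h.1, ← h.2, map_add, map_sub, map_mul, map_pow, sliceHom_ofReal,
    sliceHom_ofReal]

theorem sliceHom_conj_add {I : ℍ[ℝ]} (hI : I ^ 2 = -1) {p : ℍ[ℝ]} {z : ℂ}
    (h : sliceHom I hI z ∈ orbit p) :
    sliceHom I hI (starRingEnd ℂ z) - star p = p - sliceHom I hI z := by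
  rw [mem_orbit_iff] at h
  rw [← star_sliceHom, sub_eq_sub_iff_add_eq_add, Quaternion.star_add_self,
    Quaternion.self_add_star, h.1]

theorem sliceHom_preimage_orbitNhd {I : ℍ[ℝ]} (hI : I ^ 2 = -1) {c : ℍ[ℝ]}
    (hc : (orbit c).Nontrivial) (R : ℝ) :
    sliceEmb I ⁻¹' orbitNhd c R =
      {w | ‖(w - (c.re : ℂ)) ^ 2 + ((‖c‖ ^ 2 - c.re ^ 2 : ℝ) : ℂ)‖ < R} := by
  ext w
  have e : (w - (c.re : ℂ)) ^ 2 + ((‖c‖ ^ 2 - c.re ^ 2 : ℝ) : ℂ) =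
      w ^ 2 - ((2 * c.re : ℝ) : ℂ) * w + ((‖c‖ ^ 2 : ℝ) : ℂ) := by push_cast; ring
  have h : orbitPoly c (sliceEmb I w) =
      sliceHom I hI (w ^ 2 - ((2 * c.re : ℝ) : ℂ) * w + ((‖c‖ ^ 2 : ℝ) : ℂ)) := by
    rw [orbitPoly_eq_quadPoly hc, quadPoly, ← sliceHom_apply hI, map_add, map_sub, map_mul, map_pow,
      sliceHom_ofReal, sliceHom_ofReal]
  show ‖orbitPoly c (sliceEmb I w)‖ < R ↔ ‖_‖ < R
  rw [e, h, norm_sliceHom]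

/-! ## Skew regular functions on `ℝ + ℝ I` -/

/-- Conjugation by `w - z` fixes `w` within a slice, so the skew product becomes the ordinary one.
-/
theorem SkewRegularOn.exists_slice_eq {U : Set ℍ[ℝ]} {F : ℍ[ℝ] → ℍ[ℝ]} (hF : SkewRegularOn U F)
    {I : ℍ[ℝ]} (hI : I ^ 2 = -1) {z : ℂ} (hz : sliceHom I hI z ∈ U) :
    ∃ D : ℂ → ℍ[ℝ], ContinuousAt D z ∧ ∀ w, sliceHom I hI w ∈ U →
      F (sliceHom I hI w) = F (sliceHom I hI z) + D w * sliceHom I hI (w - z) := by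
  obtain ⟨D, hDc, hD⟩ := hF _ hz
  refine ⟨fun w => D (sliceHom I hI w), ContinuousAt.comp (g := D) (hDc _ (self_mem_orbit _))
    (continuous_sliceHom hI).continuousAt, fun w hw => ?_⟩
  rw [hD _ hw, skewMul, map_sub]
  split_ifs with h
  · rw [h, mul_zero]
  · rw [← eq_conj_of_mul_eq h]
    rw [← map_sub, ← map_mul, ← map_mul, mul_comm]

theorem isOpen_sliceHom_preimage {U : Set ℍ[ℝ]} (hU : IsOpen U) {I : ℍ[ℝ]} (hI : I ^ 2 = -1) :
    IsOpen (sliceHom I hI ⁻¹' U) := hU.preimage (continuous_sliceHom hI)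

theorem SkewRegularOn.continuousOn_slice {U : Set ℍ[ℝ]} (hU : IsOpen U) {F : ℍ[ℝ] → ℍ[ℝ]}
    (hF : SkewRegularOn U F) {I : ℍ[ℝ]} (hI : I ^ 2 = -1) :
    ContinuousOn (fun w => F (sliceHom I hI w)) (sliceHom I hI ⁻¹' U) := by
  intro z hz
  obtain ⟨D, hDc, hD⟩ := hF.exists_slice_eq hI hz
  have hc : ContinuousAt (fun w => F (sliceHom I hI z) + D w * sliceHom I hI (w - z)) z :=
    continuousAt_const.add (hDc.mul
      ((continuous_sliceHom hI).comp (continuous_id.sub continuous_const)).continuousAt)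
  refine (hc.congr ?_).continuousWithinAt
  filter_upwards [(isOpen_sliceHom_preimage hU hI).mem_nhds hz] with w hw using (hD w hw).symm

theorem SkewRegularOn.differentiableOn_slice {U : Set ℍ[ℝ]} (hU : IsOpen U) {F : ℍ[ℝ] → ℍ[ℝ]}
    (hF : SkewRegularOn U F) {I : ℍ[ℝ]} (hI : I ^ 2 = -1) (k : ℍ[ℝ]) :
    DifferentiableOn ℂ (fun w => sliceProj I (k * F (sliceHom I hI w)))
      (sliceHom I hI ⁻¹' U) := by
  intro z hz
  obtain ⟨D, hDc, hD⟩ := hF.exists_slice_eq hI hz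
  have hd : HasDerivAt (fun w => sliceProj I (k * F (sliceHom I hI w)))
      (sliceProj I (k * D z)) z := by
    rw [hasDerivAt_iff_tendsto_slope]
    have hc : ContinuousAt (fun w => sliceProj I (k * D w)) z :=
      (sliceProj I).continuous.continuousAt.comp (continuousAt_const.mul hDc)
    refine (hc.tendsto.mono_left nhdsWithin_le_nhds).congr' ?_
    filter_upwards [self_mem_nhdsWithin,
      mem_nhdsWithin_of_mem_nhds ((isOpen_sliceHom_preimage hU hI).mem_nhds hz)] with w hwz hw
    have hne : w - z ≠ 0 := sub_ne_zero.2 hwz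
    rw [slope_def_field, hD w hw, mul_add, map_add, add_sub_cancel_left, ← mul_assoc,
      sliceProj_mul, mul_div_cancel_right₀ _ hne]
  exact hd.differentiableAt.differentiableWithinAt

/-! ## Integrals over cycles in `ℝ + ℝ I` -/

/-- The integral `∫_γ F(q) (-I dq) r(q)` for a function `r` with values in `ℝ + ℝ I`. -/
def sliceIntegral {I : ℍ[ℝ]} (hI : I ^ 2 = -1) {n : ℕ} (γ : Fin n → Loop) (F : ℍ[ℝ] → ℍ[ℝ])
    (r : ℂ → ℂ) : ℍ[ℝ] :=
  ∑ j, ∫ t in (γ j).a..(γ j).b, F (sliceHom I hI ((γ j).toFun t)) *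
    sliceHom I hI (-Complex.I * (r ((γ j).toFun t) * deriv (γ j).toFun t))

section Integral

variable {I : ℍ[ℝ]} (hI : I ^ 2 = -1) {n : ℕ} {γ : Fin n → Loop} {F : ℍ[ℝ] → ℍ[ℝ]}

theorem intervalIntegrable_slice {δ : Loop}
    (hF : ContinuousOn (fun w => F (sliceHom I hI w)) δ.image) {r : ℂ → ℂ}
    (hr : ContinuousOn r δ.image) :
    IntervalIntegrable (fun t => F (sliceHom I hI (δ.toFun t)) *
      sliceHom I hI (-Complex.I * (r (δ.toFun t) * deriv δ.toFun t))) volume δ.a δ.b := by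
  have h1 := (δ.intervalIntegrable_mul_deriv hr).const_mul (-Complex.I)
  have h2 : IntervalIntegrable (fun t => sliceHom I hI
      (-Complex.I * (r (δ.toFun t) * deriv δ.toFun t))) volume δ.a δ.b :=
    ⟨(sliceCLM I hI).integrable_comp h1.1, (sliceCLM I hI).integrable_comp h1.2⟩
  refine h2.continuousOn_mul ?_
  rw [uIcc_of_le δ.lt.le]
  exact hF.comp δ.cont (mapsTo_image _ _)

theorem integral_mul_const_quaternion {f : ℝ → ℍ[ℝ]} {a b : ℝ}
    (hf : IntervalIntegrable f volume a b) (k : ℍ[ℝ]) :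
    ∫ t in a..b, f t * k = (∫ t in a..b, f t) * k :=
  ((ContinuousLinearMap.mul ℝ ℍ[ℝ]).flip k).intervalIntegral_comp_comm hf

theorem IntervalIntegrable.mul_const_quaternion {f : ℝ → ℍ[ℝ]} {a b : ℝ}
    (hf : IntervalIntegrable f volume a b) (k : ℍ[ℝ]) :
    IntervalIntegrable (fun t => f t * k) volume a b :=
  hf.mul_continuousOn continuousOn_const

/-- Slice-valued factors of the kernel commute with `-I dq`; the constant `k`, which need not lie in
the slice, stays on the far right and leaves the integral. -/
theorem cycleIntegral_eq_sliceIntegral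
    (hF : ∀ j, ContinuousOn (fun w => F (sliceHom I hI w)) (γ j).image) {r₁ r₂ : ℂ → ℂ}
    (h₁ : ∀ j, ContinuousOn r₁ (γ j).image) (h₂ : ∀ j, ContinuousOn r₂ (γ j).image)
    {K : ℍ[ℝ] → ℍ[ℝ]} {k : ℍ[ℝ]}
    (hK : ∀ j, ∀ w ∈ (γ j).image,
      K (sliceHom I hI w) = sliceHom I hI (r₁ w) + sliceHom I hI (r₂ w) * k) :
    cycleIntegral I γ F K = sliceIntegral hI γ F r₁ + sliceIntegral hI γ F r₂ * k := by
  rw [cycleIntegral, sliceIntegral, sliceIntegral, Finset.sum_mul, ← Finset.sum_add_distrib]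
  refine Finset.sum_congr rfl fun j _ => ?_
  have i₁ := intervalIntegrable_slice hI (hF j) (h₁ j)
  have i₂ := intervalIntegrable_slice hI (hF j) (h₂ j)
  rw [← integral_mul_const_quaternion i₂, ← intervalIntegral.integral_add i₁
    (IntervalIntegrable.mul_const_quaternion i₂ k), lineIntegral]
  refine intervalIntegral.integral_congr fun t ht => ?_
  rw [uIcc_of_le (γ j).lt.le] at ht
  simp only [← sliceHom_apply hI, deriv_sliceHom_comp hI]
  rw [hK j _ (mem_image_of_mem _ ht)]
  simp only [map_mul, map_neg, sliceHom_I hI, mul_add]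
  have hc : ∀ x y : ℂ, sliceHom I hI x * sliceHom I hI y = sliceHom I hI y * sliceHom I hI x :=
    fun x y => by rw [← map_mul, mul_comm, map_mul]
  rw [hc (r₁ _), hc (r₂ _)]
  noncomm_ring

theorem sliceIntegral_add_mul
    (hF : ∀ j, ContinuousOn (fun w => F (sliceHom I hI w)) (γ j).image) {r r₁ r₂ : ℂ → ℂ}
    (h₁ : ∀ j, ContinuousOn r₁ (γ j).image) (h₂ : ∀ j, ContinuousOn r₂ (γ j).image) {c₁ c₂ : ℂ}
    (hr : ∀ j, ∀ w ∈ (γ j).image, r w = r₁ w * c₁ + r₂ w * c₂) :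
    sliceIntegral hI γ F r = sliceIntegral hI γ F r₁ * sliceHom I hI c₁ +
      sliceIntegral hI γ F r₂ * sliceHom I hI c₂ := by
  rw [sliceIntegral, sliceIntegral, sliceIntegral, Finset.sum_mul, Finset.sum_mul,
    ← Finset.sum_add_distrib]
  refine Finset.sum_congr rfl fun j _ => ?_
  have i₁ := intervalIntegrable_slice hI (hF j) (h₁ j)
  have i₂ := intervalIntegrable_slice hI (hF j) (h₂ j)
  rw [← integral_mul_const_quaternion i₂, ← integral_mul_const_quaternion i₁,
    ← intervalIntegral.integral_add (IntervalIntegrable.mul_const_quaternion i₁ _)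
    (IntervalIntegrable.mul_const_quaternion i₂ _)]
  refine intervalIntegral.integral_congr fun t ht => ?_
  rw [uIcc_of_le (γ j).lt.le] at ht
  rw [hr j _ (mem_image_of_mem _ ht), mul_assoc, mul_assoc, ← map_mul, ← map_mul, ← mul_add,
    ← map_add]
  congr 2
  ring

/-- Cauchy's formula in `ℝ + ℝ I`. -/
theorem sliceIntegral_cauchy {U : Set ℍ[ℝ]} (hU : IsOpen U) (hF : SkewRegularOn U F) {a β : ℂ}
    {R : ℝ} (hR : 0 < R) (hγ : IsOrientedBoundary γ {w | ‖(w - a) ^ 2 + β‖ < R})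
    (hsub : closure {w | ‖(w - a) ^ 2 + β‖ < R} ⊆ sliceHom I hI ⁻¹' U) {z : ℂ}
    (hz : ‖(z - a) ^ 2 + β‖ < R) :
    sliceIntegral hI γ F (fun w => (w - z)⁻¹) =
      ((2 * Real.pi : ℝ) : ℍ[ℝ]) * F (sliceHom I hI z) := by
  have hFc : ∀ j, ContinuousOn (fun w => F (sliceHom I hI w)) (γ j).image := fun j =>
    (hF.continuousOn_slice hU hI).mono fun w hw =>
      hsub (frontier_subset_closure (hγ.1.subset (mem_iUnion.2 ⟨j, hw⟩)))
  have hne := fun j w hw => hγ.sub_ne_zero_of_mem hR hz j (w := w) hw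
  refine eq_of_sliceProj_eq (I := I) fun k => ?_
  have hcauchy := hγ.cauchy_formula hR (isOpen_sliceHom_preimage hU hI) hsub
    (hF.differentiableOn_slice hU hI k) hz
  set L : ℍ[ℝ] →L[ℝ] ℂ := (sliceProj I).comp (ContinuousLinearMap.mul ℝ ℍ[ℝ] k) with hL
  have hLapp : ∀ x, L x = sliceProj I (k * x) := fun x => rfl
  rw [← hLapp, sliceIntegral, map_sum]
  have hj : ∀ j, L (∫ t in (γ j).a..(γ j).b, F (sliceHom I hI ((γ j).toFun t)) *
      sliceHom I hI (-Complex.I * (((γ j).toFun t - z)⁻¹ * deriv (γ j).toFun t))) =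
      -Complex.I * ∫ t in (γ j).a..(γ j).b, sliceProj I (k * F (sliceHom I hI ((γ j).toFun t))) *
        ((γ j).toFun t - z)⁻¹ * deriv (γ j).toFun t := by
    intro j
    rw [← L.intervalIntegral_comp_comm (intervalIntegrable_slice hI (hFc j)
      (r := fun w => (w - z)⁻¹) (ContinuousOn.inv₀ (by fun_prop) (hne j))),
      ← intervalIntegral.integral_const_mul]
    refine intervalIntegral.integral_congr fun t _ => ?_
    simp only [hLapp]
    rw [← mul_assoc k, sliceProj_mul]
    ring
  rw [Finset.sum_congr rfl fun j _ => hj j, ← Finset.mul_sum, hcauchy, Quaternion.coe_mul_eq_smul,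
    mul_smul_comm, map_smul, Complex.real_smul]
  push_cast
  linear_combination (-2 * Real.pi * sliceProj I (k * F (sliceHom I hI z))) * Complex.I_sq

end Integral

/-! ## Cauchy's formulas for skew regular functions -/

section Cauchy

variable {U : Set ℍ[ℝ]} {F : ℍ[ℝ] → ℍ[ℝ]} {I : ℍ[ℝ]} {n : ℕ} {γ : Fin n → Loop} {a β : ℂ} {R : ℝ}
  {C : ℍ[ℝ]}

/-- Partial fractions: `1/((w - z)(w - z'))` is `(1/(w - z) - 1/(w - z'))/(z - z')`, and multiplying
it by `w` gives `1/(w - z)` plus `z'` times it. Cauchy's formula applies to each simple pole. -/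
theorem sliceIntegral_quad (hI : I ^ 2 = -1) (hU : IsOpen U) (hF : SkewRegularOn U F) (hR : 0 < R)
    (hγ : IsOrientedBoundary γ {w | ‖(w - a) ^ 2 + β‖ < R})
    (hsub : closure {w | ‖(w - a) ^ 2 + β‖ < R} ⊆ sliceHom I hI ⁻¹' U) {z z' : ℂ}
    (hz : ‖(z - a) ^ 2 + β‖ < R) (hz' : ‖(z' - a) ^ 2 + β‖ < R) (hne : z ≠ z')
    (hC : F (sliceHom I hI z) - F (sliceHom I hI z') =
      C * (sliceHom I hI z - sliceHom I hI z')) :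
    sliceIntegral hI γ F (fun w => ((w - z) * (w - z'))⁻¹) = ((2 * Real.pi : ℝ) : ℍ[ℝ]) * C ∧
    sliceIntegral hI γ F (fun w => w * ((w - z) * (w - z'))⁻¹) =
      ((2 * Real.pi : ℝ) : ℍ[ℝ]) * (F (sliceHom I hI z) + C * sliceHom I hI z') := by
  have h1 := fun j w hw => hγ.sub_ne_zero_of_mem hR hz j (w := w) hw
  have h2 := fun j w hw => hγ.sub_ne_zero_of_mem hR hz' j (w := w) hw
  have hFc : ∀ j, ContinuousOn (fun w => F (sliceHom I hI w)) (γ j).image := fun j =>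
    (hF.continuousOn_slice hU hI).mono fun w hw =>
      hsub (frontier_subset_closure (hγ.1.subset (mem_iUnion.2 ⟨j, hw⟩)))
  have c1 : ∀ j, ContinuousOn (fun w => (w - z)⁻¹) (γ j).image := fun j =>
    ContinuousOn.inv₀ (by fun_prop) (h1 j)
  have c2 : ∀ j, ContinuousOn (fun w => (w - z')⁻¹) (γ j).image := fun j =>
    ContinuousOn.inv₀ (by fun_prop) (h2 j)
  have hs : z - z' ≠ 0 := sub_ne_zero.2 hne
  have hA := sliceIntegral_cauchy hI hU hF hR hγ hsub hz
  have hA' := sliceIntegral_cauchy hI hU hF hR hγ hsub hz'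
  have hdiff : C = (F (sliceHom I hI z) - F (sliceHom I hI z')) * sliceHom I hI (z - z')⁻¹ := by
    rw [hC, mul_assoc, ← map_sub, ← map_mul, mul_inv_cancel₀ hs, map_one, mul_one]
  constructor
  · rw [sliceIntegral_add_mul hI hFc c1 c2 (c₁ := (z - z')⁻¹) (c₂ := -(z - z')⁻¹) fun j w hw => ?_,
      hA, hA', hdiff, map_neg]
    · noncomm_ring
    · have e1 := h1 j w hw
      have e2 := h2 j w hw
      field_simp
      ring
  · rw [sliceIntegral_add_mul hI hFc c1 c2 (c₁ := 1 + (z - z')⁻¹ * z')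
      (c₂ := -((z - z')⁻¹ * z')) fun j w hw => ?_, hA, hA', hdiff, map_neg, map_add, map_mul, map_one]
    · noncomm_ring
    · have e1 := h1 j w hw
      have e2 := h2 j w hw
      field_simp
      ring

end Cauchy

theorem mem_orbitNhd_of_mem_orbit {c x p : ℍ[ℝ]} {R : ℝ} (hc : (orbit c).Nontrivial)
    (hp : p ∈ orbitNhd c R) (hx : x ∈ orbit p) : x ∈ orbitNhd c R := by
  show ‖orbitPoly c x‖ < R
  rw [norm_orbitPoly_eq_of_mem hc hx]
  exact hp

theorem sliceHom_ne_conj {I : ℍ[ℝ]} (hI : I ^ 2 = -1) {p : ℍ[ℝ]} (hp : (orbit p).Nontrivial) {z : ℂ}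
    (hz : sliceHom I hI z ∈ orbit p) : z ≠ starRingEnd ℂ z := by
  intro h
  obtain ⟨r, rfl⟩ := Complex.conj_eq_iff_real.1 h.symm
  rw [sliceHom_ofReal] at hz
  rw [← orbit_eq_of_mem hz] at hp
  exact Set.not_nontrivial_iff.2 (orbit_coe_subsingleton r) hp

/-- Cauchy's formulas for skew regular functions. -/
theorem SkewRegularOn.cauchy_formulas {U : Set ℍ[ℝ]} (hU : IsRegion U) {F : ℍ[ℝ] → ℍ[ℝ]}
    (hF : SkewRegularOn U F) {c : ℍ[ℝ]} (hc : (orbit c).Nontrivial) {R : ℝ} (hR : 0 < R)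
    (hUR : closure (orbitNhd c R) ⊆ U) {I : ℍ[ℝ]} (hI : I ^ 2 = -1) {n : ℕ} {γ : Fin n → Loop}
    (hγ : IsOrientedBoundary γ (sliceEmb I ⁻¹' orbitNhd c R)) {p : ℍ[ℝ]} (hp : p ∈ orbitNhd c R) :
    cycleIntegral I γ F (cauchyKernel p) = ((2 * Real.pi : ℝ) : ℍ[ℝ]) * F p ∧
    ((orbit p).Nontrivial → HasOrbitalDeriv F
      ((1 / (2 * Real.pi) : ℝ) • cycleIntegral I γ F (fun q => (orbitPoly p q)⁻¹)) p) := by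
  have hmem : ∀ w, sliceHom I hI w ∈ orbitNhd c R ↔
      ‖(w - (c.re : ℂ)) ^ 2 + ((‖c‖ ^ 2 - c.re ^ 2 : ℝ) : ℂ)‖ < R := fun w => by
    rw [sliceHom_apply]
    exact Set.ext_iff.1 (sliceHom_preimage_orbitNhd hI hc R) w
  have hsub : closure {w : ℂ | ‖(w - (c.re : ℂ)) ^ 2 + ((‖c‖ ^ 2 - c.re ^ 2 : ℝ) : ℂ)‖ < R} ⊆
      sliceHom I hI ⁻¹' U := by
    refine (closure_minimal (fun w hw => ?_) (isClosed_closure.preimage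
      (continuous_sliceHom hI))).trans (preimage_mono hUR)
    exact subset_closure ((hmem w).2 hw)
  rw [sliceHom_preimage_orbitNhd hI hc] at hγ
  have hFc : ∀ j, ContinuousOn (fun w => F (sliceHom I hI w)) (γ j).image := fun j =>
    (hF.continuousOn_slice hU.1 hI).mono fun w hw =>
      hsub (frontier_subset_closure (hγ.1.subset (mem_iUnion.2 ⟨j, hw⟩)))
  have hpU : p ∈ U := hUR (subset_closure hp)
  obtain ⟨z, hz⟩ := exists_sliceHom_mem_orbit hI p
  have hz' := sliceHom_conj_mem_orbit hI hz
  have hzD := (hmem z).1 (mem_orbitNhd_of_mem_orbit hc hp hz)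
  have hzD' := (hmem _).1 (mem_orbitNhd_of_mem_orbit hc hp hz')
  have hne := fun j w hw => hγ.sub_ne_zero_of_mem hR hzD j (w := w) hw
  have hne' := fun j w hw => hγ.sub_ne_zero_of_mem hR hzD' j (w := w) hw
  have hcont : ∀ j, ContinuousOn (fun w => ((w - z) * (w - starRingEnd ℂ z))⁻¹) (γ j).image :=
    fun j => ContinuousOn.inv₀ (by fun_prop) fun w hw => mul_ne_zero (hne j w hw) (hne' j w hw)
  have hcont' : ∀ j, ContinuousOn (fun w => w * ((w - z) * (w - starRingEnd ℂ z))⁻¹) (γ j).image :=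
    fun j => continuousOn_id.mul (hcont j)
  have hker : ∀ j, ∀ w ∈ (γ j).image, cauchyKernel p (sliceHom I hI w) =
      sliceHom I hI (w * ((w - z) * (w - starRingEnd ℂ z))⁻¹) +
        sliceHom I hI (((w - z) * (w - starRingEnd ℂ z))⁻¹) * -star p := by
    intro j w hw
    have hnot : sliceHom I hI w ∉ orbit p := fun h => by
      have h1 := (hmem w).1 (mem_orbitNhd_of_mem_orbit hc hp h)
      exact hγ.sub_ne_zero_of_mem hR h1 j hw (sub_self w)
    rw [cauchyKernel_eq hnot, quadPoly_sliceHom hI hz, ← map_inv₀, mul_comm w, map_mul _ _ w]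
    noncomm_ring
  have hcyc := cycleIntegral_eq_sliceIntegral hI hFc hcont' hcont hker
  obtain ⟨C, hC⟩ := exists_orbital_const hU hF hpU
  by_cases hnt : (orbit p).Nontrivial
  · obtain ⟨hq₁, hq₂⟩ := sliceIntegral_quad hI hU.1 hF hR hγ hsub hzD hzD'
      (sliceHom_ne_conj hI hnt hz) (hC _ hz _ hz')
    constructor
    · have h1 : F p = F (sliceHom I hI z) + C * (p - sliceHom I hI z) := by
        rw [← hC p (self_mem_orbit p) _ hz, add_sub_cancel]
      -- As `p` and `z` have the same real part, `z̄ - p̄ = p - z`.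
      rw [hcyc, hq₁, hq₂, h1, ← sliceHom_conj_add hI hz]
      noncomm_ring
    · intro _
      have hcyc' : cycleIntegral I γ F (fun q => (orbitPoly p q)⁻¹) =
          ((2 * Real.pi : ℝ) : ℍ[ℝ]) * C := by
        rw [cycleIntegral_eq_sliceIntegral hI hFc hcont hcont (k := 0) fun j w _ => ?_, hq₁,
          mul_zero, add_zero]
        rw [orbitPoly_eq_quadPoly hnt, quadPoly_sliceHom hI hz, ← map_inv₀, mul_zero, add_zero]
      rw [hcyc', Quaternion.coe_mul_eq_smul, smul_smul, one_div_mul_cancel Real.two_pi_pos.ne',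
        one_smul]
      refine ⟨skewConvexOn_of_affine hC, fun _ x hx y hy hxy => ?_, fun h => absurd hnt h⟩
      rw [hC x hx y hy, mul_inv_cancel_right₀ (sub_ne_zero.2 hxy)]
  · refine ⟨?_, fun h => absurd h hnt⟩
    have hzp : sliceHom I hI z = p := Set.not_nontrivial_iff.1 hnt hz (self_mem_orbit p)
    have hstar : star p = sliceHom I hI (starRingEnd ℂ z) := by rw [← star_sliceHom, hzp]
    -- On a trivial orbit `z = z̄ = p`, so the double pole cancels against `w - p̄` and a simple
    -- pole remains.
    rw [cycleIntegral_eq_sliceIntegral hI hFc (r₁ := fun w => (w - z)⁻¹)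
      (fun j => ContinuousOn.inv₀ (by fun_prop) (hne j)) (hcont) (k := 0) fun j w hw => ?_,
      sliceIntegral_cauchy hI hU.1 hF hR hγ hsub hzD, hzp, mul_zero, add_zero]
    rw [hker j w hw, hstar, mul_zero, add_zero, ← map_neg, ← map_mul, ← map_add]
    congr 1
    have e1 := hne j w hw
    have e2 := hne' j w hw
    field_simp
    ring

end SkewAnalysis
end

theorem mainTheorem9 (U : Set ℍ[ℝ]) (hU : IsRegion U) (F : ℍ[ℝ] → ℍ[ℝ])
    (hF : SkewRegularOn U F) (c : ℍ[ℝ]) (hc : (SkewAnalysis.orbit c).Nontrivial)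
    (R : ℝ) (hR : 0 < R) (hUR : closure (orbitNhd c R) ⊆ U)
    (I : ℍ[ℝ]) (hI : I ^ 2 = -1) :
    (∃ (n : ℕ) (γ : Fin n → Loop), IsOrientedBoundary γ (sliceEmb I ⁻¹' orbitNhd c R)) ∧
    ∀ (n : ℕ) (γ : Fin n → Loop), IsOrientedBoundary γ (sliceEmb I ⁻¹' orbitNhd c R) →
      (∀ p ∈ orbitNhd c R,
        F p = (1 / (2 * Real.pi) : ℝ) • cycleIntegral I γ F (cauchyKernel p)) ∧
      (∀ p ∈ orbitNhd c R, (SkewAnalysis.orbit p).Nontrivial →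
        HasOrbitalDeriv F
          ((1 / (2 * Real.pi) : ℝ) • cycleIntegral I γ F (fun q => (orbitPoly p q)⁻¹)) p) := by
  refine ⟨?_, fun n γ hγ => ⟨fun p hp => ?_, fun p hp hnt =>
    (hF.cauchy_formulas hU hc hR hUR hI hγ hp).2 hnt⟩⟩
  · rw [sliceHom_preimage_orbitNhd hI hc]
    exact exists_isOrientedBoundary _ (sub_nonneg.2 (re_sq_le_norm_sq c)) hR
  · rw [(hF.cauchy_formulas hU hc hR hUR hI hγ hp).1, Quaternion.coe_mul_eq_smul, smul_smul,
      one_div_mul_cancel Real.two_pi_pos.ne', one_smul]
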